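/- Let $\mathcal X,\mathcal Y$ be finite sets, $\mathcal X\neq\emptyset$, and let $W=(W_x)_{x\in\mathcal X}$ be a channel from $\mathcal X$ to $\mathcal Y$, i.e. each $W_x$ is a probability distribution on $\mathcal Y$; put $W^n_{x^n}(y^n)=\prod_{i=1}^n W_{x_i}(y_i)$. For a probability distribution $P$ on $\mathcal X$ let $PW=\sum_x P(x)W_x$ and $I(P;W)=H(PW)-\sum_x P(x)H(W_x)$, where $H$ is Shannon entropy (all logarithms to one fixed base). A simulation of $W$ together with its noiseless passive feedback, of block length $n$ and with error $\lambda$, consists of a common random variable $\nu\in\{1,\dots,N\}$ with some distribution $\xi$, independent of the input, stochastic encoders $E_\nu$ from $\mathcal X^n$ to $\{1,\dots,M\}$, and deterministic decoders $D_\nu:\{1,\dots,M\}\to\mathcal Y^n$ (so that the sender, who knows $\nu$ and the message sent, knows the receiver's output exactly), such that $$\tfrac12\Big\|W^n_{x^n}-\sum_\nu \xi_\nu\,D_\nu(E_\nu(x^n))\Big\|_1\le\lambda\qquad\text{for every }x^n\in\mathcal X^n .$$ Its communication rate is $\frac1n\log M$ and its common-randomness rate is $\frac1n\log N$. A pair $(R,C)$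 of real numbers is called achievable with error $\lambda$ if for every $\varepsilon>0$ and all sufficiently large $n$ there is such a simulation with $\xi$ uniform, communication rate at most $R+\varepsilon$ and common-randomness rate at most $C+\varepsilon$. Then the maxima $C(W)=\max_P I(P;W)$ and $\max_P H(PW)$ exist, and: 1. (Lower bounds.) For every $\lambda<1$ and $\varepsilon>0$ there is $n_0$ such that for all $n\ge n_0$ every simulation of block length $n$ with error $\lambda$ (with arbitrary $M$, $N$ and $\xi$), of communication rate $R$ and common-randomness rate $C$, satisfies $$R\ge C(W)-\varepsilon,\qquad R+C\ge \max_P H(PW)-\varepsilon .$$ 2. (Rate region.) For every $\lambda\in(0,1)$, a pair $(R,C)$ is achievable with error $\lambda$ if and only if $$C\ge0,\qquad R\ge C(W),\qquad R+C\ge\max_P H(PW).$$ -/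

import Mathlib

open Filter

namespace ChannelSimulation

noncomputable section

/-- Shannon entropy (in nats) of a probability vector on a finite set. -/
def entropy {A : Type*} [Fintype A] (p : A → ℝ) : ℝ := ∑ a, Real.negMulLog (p a)

/-- The output distribution `PW = ∑ x, P x • W x`. -/
def outputDist {X Y : Type*} [Fintype X] [Fintype Y]
    (P : stdSimplex ℝ X) (W : X → stdSimplex ℝ Y) : Y → ℝ :=
  fun y => ∑ x, P x * W x y

/-- Mutual information `I(P;W) = H(PW) - ∑ x, P x * H(W x)`. -/
def mutualInfo {X Y : Type*} [Fintype X] [Fintype Y]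
    (P : stdSimplex ℝ X) (W : X → stdSimplex ℝ Y) : ℝ :=
  entropy (outputDist P W) - ∑ x, P x * entropy (W x)

/-- The capacity `C(W)`: supremum of `I(P;W)` over all input distributions. -/
def capacity {X Y : Type*} [Fintype X] [Fintype Y] (W : X → stdSimplex ℝ Y) : ℝ :=
  ⨆ P : stdSimplex ℝ X, mutualInfo P W

/-- The supremum of `H(PW)` over all input distributions. -/
def maxOutputEntropy {X Y : Type*} [Fintype X] [Fintype Y] (W : X → stdSimplex ℝ Y) : ℝ :=
  ⨆ P : stdSimplex ℝ X, entropy (outputDist P W)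

/-- The memoryless extension `W^n`: `W^n(y^n | x^n) = ∏ i, W(y_i | x_i)`. -/
def power {X Y : Type*} [Fintype Y] (W : X → stdSimplex ℝ Y) {n : ℕ}
    (x : Fin n → X) (y : Fin n → Y) : ℝ :=
  ∏ i, W (x i) (y i)

/-- Total variation distance, i.e. half the `ℓ¹` distance. -/
def tvDist {A : Type*} [Fintype A] (p q : A → ℝ) : ℝ := 2⁻¹ * ∑ a, |p a - q a|

/-- A code of block length `n` with `M` messages and common randomness `ν` taking `N` values.
Given `ν` and the input word, the sender draws a message `c` from `enc ν x`; the receiver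
outputs the word `dec ν c`.  The decoder is a function of `ν` and `c`, both of which the sender
knows as well, so that the sender obtains an exact copy of the receiver's output: this is
what makes the code provide the noiseless passive feedback. -/
structure FeedbackCode (X Y : Type*) (n M N : ℕ) where
  /-- the distribution of the common randomness -/
  cr : stdSimplex ℝ (Fin N)
  /-- the stochastic encoders -/
  enc : Fin N → (Fin n → X) → stdSimplex ℝ (Fin M)
  /-- the deterministic decoders -/
  dec : Fin N → Fin M → (Fin n → Y)

namespace FeedbackCode

variable {X Y : Type*} {n M N : ℕ}

open Classical in
/-- The law of the output word (at the receiver, and of its copy at the sender) for the input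
word `x`: the average over `ν` of the image of `enc ν x` under `dec ν`. -/
def outputLaw (S : FeedbackCode X Y n M N) (x : Fin n → X) (y : Fin n → Y) : ℝ :=
  ∑ ν, S.cr ν * ∑ c, if S.dec ν c = y then S.enc ν x c else 0

/-- The common randomness is uniformly distributed on its `N` values. -/
def IsUniform (S : FeedbackCode X Y n M N) : Prop := ∀ ν, S.cr ν = (N : ℝ)⁻¹

/-- The code simulates `W^n` with error at most `lam`, for every individual input word. -/
def Simulates [Fintype Y] (S : FeedbackCode X Y n M N)
    (W : X → stdSimplex ℝ Y) (lam : ℝ) : Prop :=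
  ∀ x : Fin n → X, tvDist (power W x) (S.outputLaw x) ≤ lam

/-- Communication rate `(1/n) log M`. -/
def rate (_S : FeedbackCode X Y n M N) : ℝ := Real.log M / n

/-- Common randomness rate `(1/n) log N`. -/
def crRate (_S : FeedbackCode X Y n M N) : ℝ := Real.log N / n

end FeedbackCode

/-- `(R, C)` is an achievable pair of communication rate and (uniform) common randomness rate
for simulating `W` with noiseless passive feedback and error `lam`. -/
def IsAchievable {X Y : Type*} [Fintype Y] (W : X → stdSimplex ℝ Y) (lam R C : ℝ) : Prop :=
  ∀ ε > 0, ∀ᶠ n : ℕ in atTop, ∃ (M N : ℕ) (S : FeedbackCode X Y n M N),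
    S.IsUniform ∧ S.Simulates W lam ∧ S.rate ≤ R + ε ∧ S.crRate ≤ C + ε

end

end ChannelSimulation

/-!
The converse bounds come from two features of a code in which the decoder is deterministic.
For each value of the common randomness there are only `M` possible outputs, so all output laws are
dominated by one measure of mass `M` that does not depend on the input
(`FeedbackCode.outputLaw_le_multiplicity`). Under an i.i.d. input with distribution `P`, the channel
puts almost all its mass on pairs whose likelihood ratio `W^n / (PW)^n` is about
`exp (n I(P;W))`, while such pairs have weight at most `M exp (-n I(P;W))` under the code
(`FeedbackCode.sum_highDensity_le`). Hence `M` cannot be smaller than `exp (n I(P;W))` in the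
exponent, whatever the error below `1` is. Likewise at most `M * N` output words are possible at
all, whereas `(PW)^n` is spread over about `exp (n H(PW))` words (`FeedbackCode.sum_smallProb_le`).

For achievability the words of a codebook with `N` blocks of `M` words are drawn independently from
a distribution `Q` on output words. The common randomness selects a block, and the sender selects a
word of the block with probability proportional to the likelihood ratio of `W^n_x` and `Q`. On the
outputs that are typical for `x` this ratio has to be at most `exp (n C(W))`, so that blocks with
more words than that have nearly constant total weight; and `Q` has to be at least
`exp (-n max H(PW))` there, so that a book with more words than the reciprocal is nearly
distributed according to `Q` (`mean_error_bookLaw_le`); all this up to factors `exp (n ε)`. One `Q`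
serves all inputs, namely the uniform mixture of the i.i.d. distributions `(PW)^n` over the
empirical distributions `P` of words (`exists_universal_dist`, `prob_isTypical_ge`).

This makes the expected error small for each input separately. A greedy choice of `n ^ 2` codebooks
makes the average error small for all inputs at once (`exists_list_sum_err_le`), and letting the
common randomness also choose among these books does not affect its rate.
-/

namespace ChannelSimulation

/-! ### Product distributions on finite sets -/

section Product

variable {ι A : Type*} [Fintype ι] [DecidableEq ι] [Fintype A]

theorem sum_prod_eq_one {p : ι → A → ℝ} (hp : ∀ i, ∑ a, p i a = 1) :
    ∑ a : ι → A, ∏ i, p i (a i) = 1 := by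
  rw [← Fintype.prod_sum]
  simp [hp]

theorem sum_prod_mul_coord {p : ι → A → ℝ} (hp : ∀ i, ∑ a, p i a = 1) (j : ι) (f : A → ℝ) :
    ∑ a : ι → A, (∏ i, p i (a i)) * f (a j) = ∑ b, p j b * f b := by
  have h : ∀ a : ι → A, (∏ i, p i (a i)) * f (a j)
      = ∏ i, (p i (a i) * if i = j then f (a i) else 1) := by
    intro a
    rw [Finset.prod_mul_distrib]
    simp
  simp_rw [h]
  rw [← Fintype.prod_sum (fun i b => p i b * if i = j then f b else 1),
    Finset.prod_eq_single j]
  · simp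
  · intro i _ hij
    simp [hij, hp]
  · simp

theorem sum_prod_mul_two_coord {p : ι → A → ℝ} {j k : ι}
    (hjk : j ≠ k) {f g : A → ℝ} (hf : ∑ b, p j b * f b = 0) :
    ∑ a : ι → A, (∏ i, p i (a i)) * (f (a j) * g (a k)) = 0 := by
  have h : ∀ a : ι → A, (∏ i, p i (a i)) * (f (a j) * g (a k))
      = ∏ i, (p i (a i) * ((if i = j then f (a i) else 1) * if i = k then g (a i) else 1)) := by
    intro a
    rw [Finset.prod_mul_distrib, Finset.prod_mul_distrib]
    simp
  simp_rw [h]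
  rw [← Fintype.prod_sum (fun i b => p i b * ((if i = j then f b else 1) *
    if i = k then g b else 1))]
  refine Finset.prod_eq_zero (Finset.mem_univ j) ?_
  simpa [hjk] using hf

/-- For independent centred random variables the second moment of the sum is the sum of the
second moments. -/
theorem sum_prod_mul_sq_sum {p : ι → A → ℝ} (hp : ∀ i, ∑ a, p i a = 1) {g : ι → A → ℝ}
    (hg : ∀ i, ∑ a, p i a * g i a = 0) :
    ∑ a : ι → A, (∏ i, p i (a i)) * (∑ i, g i (a i)) ^ 2 = ∑ i, ∑ b, p i b * g i b ^ 2 := by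
  simp_rw [sq, Finset.sum_mul_sum, Finset.mul_sum]
  rw [Finset.sum_comm]
  refine Finset.sum_congr rfl fun j _ => ?_
  rw [Finset.sum_comm, Finset.sum_eq_single j]
  · exact sum_prod_mul_coord hp j fun b => g j b * g j b
  · intro k _ hkj
    exact sum_prod_mul_two_coord (Ne.symm hkj) (hg j)
  · simp

/-- Centring does not increase a second moment. -/
theorem sum_mul_sub_mean_sq_le {p : A → ℝ} (hp : ∑ a, p a = 1) (f : A → ℝ) :
    ∑ a, p a * (f a - ∑ b, p b * f b) ^ 2 ≤ ∑ a, p a * f a ^ 2 := by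
  set m := ∑ b, p b * f b with hm
  have h : ∑ a, p a * (f a - m) ^ 2 = ∑ a, p a * f a ^ 2 - 2 * m * ∑ a, p a * f a
      + m ^ 2 * ∑ a, p a := by
    simp_rw [Finset.mul_sum]
    rw [← Finset.sum_sub_distrib, ← Finset.sum_add_distrib]
    exact Finset.sum_congr rfl fun a _ => by ring
  rw [h, hp, ← hm]
  nlinarith [sq_nonneg m]

theorem sum_mul_sub_mean {p : A → ℝ} (hp : ∑ a, p a = 1) (f : A → ℝ) :
    ∑ a, p a * (f a - ∑ b, p b * f b) = 0 := by
  simp_rw [mul_sub, Finset.sum_sub_distrib, ← Finset.sum_mul]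
  rw [hp, one_mul, sub_self]

/-- The variance of a sum of independent random variables, bounded by second moments. -/
theorem variance_sum_le {p : ι → A → ℝ} (hp : ∀ i, ∑ a, p i a = 1) (f : ι → A → ℝ) :
    ∑ a : ι → A, (∏ i, p i (a i)) * (∑ i, f i (a i) - ∑ i, ∑ b, p i b * f i b) ^ 2
      ≤ ∑ i, ∑ b, p i b * f i b ^ 2 := by
  have h := sum_prod_mul_sq_sum hp (g := fun i a => f i a - ∑ b, p i b * f i b)
    fun i => sum_mul_sub_mean (hp i) (f i)
  simp_rw [Finset.sum_sub_distrib] at h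
  rw [h]
  exact Finset.sum_le_sum fun i _ => sum_mul_sub_mean_sq_le (hp i) (f i)

/-- Chebyshev's inequality for sums of independent random variables: an event which contains all
sequences of positive probability whose sum is within `t` of its mean is likely. -/
theorem chebyshev {p : ι → A → ℝ} (hp0 : ∀ i a, 0 ≤ p i a) (hp : ∀ i, ∑ a, p i a = 1)
    (f : ι → A → ℝ) {t : ℝ} (ht : 0 < t) (good : (ι → A) → Prop)
    [DecidablePred good]
    (hgood : ∀ a : ι → A, (∀ i, 0 < p i (a i)) →
      |∑ i, f i (a i) - ∑ i, ∑ b, p i b * f i b| < t → good a) :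
    1 - (∑ i, ∑ b, p i b * f i b ^ 2) / t ^ 2
      ≤ ∑ a : ι → A, if good a then ∏ i, p i (a i) else 0 := by
  set m := ∑ i, ∑ b, p i b * f i b
  have h0 : ∀ a : ι → A, 0 ≤ ∏ i, p i (a i) := fun a => Finset.prod_nonneg fun i _ => hp0 i _
  have h1 : ∀ a : ι → A, (∏ i, p i (a i)) - (∏ i, p i (a i)) * (∑ i, f i (a i) - m) ^ 2 / t ^ 2
      ≤ if good a then ∏ i, p i (a i) else 0 := by
    intro a
    split_ifs with hg
    · have := mul_nonneg (h0 a) (sq_nonneg (∑ i, f i (a i) - m))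
      have := div_nonneg this (sq_nonneg t)
      linarith
    · by_cases hpos : ∀ i, 0 < p i (a i)
      · have hge : t ≤ |∑ i, f i (a i) - m| := not_lt.mp fun h => hg (hgood a hpos h)
        have hsq : t ^ 2 ≤ (∑ i, f i (a i) - m) ^ 2 := by
          rw [← sq_abs (∑ i, f i (a i) - m)]
          exact pow_le_pow_left₀ ht.le hge 2
        rw [sub_nonpos, le_div_iff₀ (by positivity)]
        exact mul_le_mul_of_nonneg_left hsq (h0 a)
      · push Not at hpos
        obtain ⟨i, hi⟩ := hpos
        have : ∏ i, p i (a i) = 0 :=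
          Finset.prod_eq_zero (Finset.mem_univ i) (le_antisymm hi (hp0 i _))
        simp [this]
  refine le_trans ?_ (Finset.sum_le_sum fun a _ => h1 a)
  rw [Finset.sum_sub_distrib, sum_prod_eq_one hp, ← Finset.sum_div]
  have := variance_sum_le hp f
  gcongr

end Product

/-! ### Output distributions and memoryless channels -/

section Channel

variable {X Y : Type*} [Fintype Y]

theorem outputDist_nonneg [Fintype X] (P : stdSimplex ℝ X) (W : X → stdSimplex ℝ Y) (y : Y) :
    0 ≤ outputDist P W y :=
  Finset.sum_nonneg fun x _ => mul_nonneg (stdSimplex.zero_le P x) (stdSimplex.zero_le (W x) y)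

theorem sum_outputDist [Fintype X] (P : stdSimplex ℝ X) (W : X → stdSimplex ℝ Y) :
    ∑ y, outputDist P W y = 1 := by
  unfold outputDist
  rw [Finset.sum_comm]
  simp_rw [← Finset.mul_sum, stdSimplex.sum_eq_one, mul_one, stdSimplex.sum_eq_one]

theorem mul_le_outputDist [Fintype X] (P : stdSimplex ℝ X) (W : X → stdSimplex ℝ Y) (x : X)
    (y : Y) : P x * W x y ≤ outputDist P W y :=
  Finset.single_le_sum (f := fun x => P x * W x y)
    (fun x _ => mul_nonneg (stdSimplex.zero_le P x) (stdSimplex.zero_le (W x) y))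
    (Finset.mem_univ x)

/-- Averaging a function of the output over the input distribution. -/
theorem sum_outputDist_mul [Fintype X] (P : stdSimplex ℝ X) (W : X → stdSimplex ℝ Y) (f : Y → ℝ) :
    ∑ y, outputDist P W y * f y = ∑ x, P x * ∑ y, W x y * f y := by
  simp_rw [outputDist, Finset.sum_mul, Finset.mul_sum]
  rw [Finset.sum_comm]
  simp_rw [mul_assoc]

theorem power_nonneg (W : X → stdSimplex ℝ Y) {n : ℕ} (x : Fin n → X) (y : Fin n → Y) :
    0 ≤ power W x y :=
  Finset.prod_nonneg fun _ _ => stdSimplex.zero_le _ _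

theorem sum_power (W : X → stdSimplex ℝ Y) {n : ℕ} (x : Fin n → X) : ∑ y, power W x y = 1 :=
  sum_prod_eq_one (p := fun i => W (x i)) fun i => stdSimplex.sum_eq_one (W (x i))

/-- Independent identically distributed inputs give independent identically distributed
outputs. -/
theorem sum_prod_mul_power [Fintype X] (P : stdSimplex ℝ X) (W : X → stdSimplex ℝ Y) {n : ℕ}
    (y : Fin n → Y) :
    ∑ x : Fin n → X, (∏ i, P (x i)) * power W x y = ∏ i, outputDist P W (y i) := by
  unfold outputDist power
  rw [Fintype.prod_sum]
  simp_rw [Finset.prod_mul_distrib]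

theorem entropy_eq_neg_sum {A : Type*} [Fintype A] (p : A → ℝ) :
    entropy p = -∑ a, p a * Real.log (p a) := by
  simp [entropy, Real.negMulLog]

/-- The mutual information as the mean of the information density. -/
theorem mutualInfo_eq_sum [Fintype X] (P : stdSimplex ℝ X) (W : X → stdSimplex ℝ Y) :
    mutualInfo P W =
      ∑ x, P x * ∑ y, W x y * (Real.log (W x y) - Real.log (outputDist P W y)) := by
  rw [mutualInfo, entropy_eq_neg_sum, sum_outputDist_mul]
  simp_rw [entropy_eq_neg_sum, mul_sub, Finset.sum_sub_distrib, mul_sub, Finset.sum_sub_distrib]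
  simp
  ring

end Channel

/-! ### Converse bounds -/

theorem sum_ite_le_add_tvDist {A : Type*} [Fintype A] {p q : A → ℝ} (hpq : ∑ a, p a = ∑ a, q a)
    (φ : A → Prop) [DecidablePred φ] :
    ∑ a, (if φ a then p a else 0) ≤ ∑ a, (if φ a then q a else 0) + tvDist p q := by
  have h : ∀ a, (if φ a then p a else 0)
      ≤ (if φ a then q a else 0) + 2⁻¹ * (|p a - q a| + (p a - q a)) := by
    intro a
    split_ifs
    · linarith [le_abs_self (p a - q a)]
    · linarith [neg_abs_le (p a - q a)]
  refine (Finset.sum_le_sum fun a _ => h a).trans ?_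
  rw [Finset.sum_add_distrib, ← Finset.mul_sum, Finset.sum_add_distrib, Finset.sum_sub_distrib,
    hpq, sub_self, add_zero, tvDist]

namespace FeedbackCode

variable {X Y : Type*} {n M N : ℕ}

theorem one_le_crCard (S : FeedbackCode X Y n M N) : 1 ≤ N := by
  rcases Nat.eq_zero_or_pos N with rfl | h
  · have := stdSimplex.sum_eq_one S.cr
    simp at this
  · exact h

theorem one_le_messageCard [Nonempty X] (S : FeedbackCode X Y n M N) : 1 ≤ M := by
  rcases Nat.eq_zero_or_pos M with rfl | h
  · have := stdSimplex.sum_eq_one (S.enc ⟨0, S.one_le_crCard⟩ fun _ => Classical.arbitrary X)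
    simp at this
  · exact h

open scoped Classical in
theorem sum_outputLaw [Fintype Y] (S : FeedbackCode X Y n M N) (x : Fin n → X) :
    ∑ y, S.outputLaw x y = 1 := by
  unfold outputLaw
  rw [Finset.sum_comm]
  simp_rw [← Finset.mul_sum]
  have : ∀ ν, ∑ y, ∑ c, (if S.dec ν c = y then S.enc ν x c else 0) = 1 := by
    intro ν
    rw [Finset.sum_comm]
    simp
  simp_rw [this, mul_one]
  exact stdSimplex.sum_eq_one S.cr

open scoped Classical in
/-- The expected number of messages that the decoder maps to the word `y`. -/
noncomputable def multiplicity (S : FeedbackCode X Y n M N) (y : Fin n → Y) : ℝ :=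
  ∑ ν, S.cr ν * ∑ c, if S.dec ν c = y then 1 else 0

theorem multiplicity_nonneg (S : FeedbackCode X Y n M N) (y : Fin n → Y) :
    0 ≤ S.multiplicity y :=
  Finset.sum_nonneg fun ν _ => mul_nonneg (stdSimplex.zero_le S.cr ν)
    (Finset.sum_nonneg fun c _ => by split_ifs <;> norm_num)

theorem sum_multiplicity [Fintype Y] (S : FeedbackCode X Y n M N) :
    ∑ y, S.multiplicity y = M := by
  classical
  unfold multiplicity
  rw [Finset.sum_comm]
  simp_rw [← Finset.mul_sum]
  have : ∀ ν, ∑ y, ∑ c, (if S.dec ν c = y then (1 : ℝ) else 0) = M := by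
    intro ν
    rw [Finset.sum_comm]
    simp
  simp_rw [this]
  rw [← Finset.sum_mul, stdSimplex.sum_eq_one S.cr, one_mul]

theorem outputLaw_le_multiplicity (S : FeedbackCode X Y n M N) (x : Fin n → X)
    (y : Fin n → Y) : S.outputLaw x y ≤ S.multiplicity y := by
  refine Finset.sum_le_sum fun ν _ => mul_le_mul_of_nonneg_left ?_ (stdSimplex.zero_le S.cr ν)
  refine Finset.sum_le_sum fun c _ => ?_
  split_ifs
  · exact stdSimplex.le_one _ _
  · exact le_rfl

open scoped Classical in
/-- The outputs of a code are dominated by a measure of total mass `M` that does not depend on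
the input.  Pairs whose likelihood ratio exceeds `K` therefore have total weight at most `M / K`
under the code, and their weight under the channel is at most `lam` larger. -/
theorem sum_highDensity_le [Fintype X] [Fintype Y] {W : X → stdSimplex ℝ Y} {lam : ℝ}
    (S : FeedbackCode X Y n M N) (hS : S.Simulates W lam) (P : stdSimplex ℝ X) {K : ℝ}
    (hK : 0 < K) :
    ∑ x : Fin n → X, (∏ i, P (x i)) * ∑ y, (if 0 < power W x y ∧
        K * ∏ i, outputDist P W (y i) ≤ power W x y then power W x y else 0) ≤ lam + M / K := by
  set φ : (Fin n → X) → (Fin n → Y) → Prop := fun x y =>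
    0 < power W x y ∧ K * ∏ i, outputDist P W (y i) ≤ power W x y with hφ
  have hP0 : ∀ x : Fin n → X, 0 ≤ ∏ i, P (x i) :=
    fun x => Finset.prod_nonneg fun i _ => stdSimplex.zero_le P _
  have hP1 : ∑ x : Fin n → X, ∏ i, P (x i) = 1 :=
    sum_prod_eq_one (p := fun _ => P) fun _ => stdSimplex.sum_eq_one P
  have hq0 : ∀ y : Fin n → Y, 0 ≤ ∏ i, outputDist P W (y i) :=
    fun y => Finset.prod_nonneg fun i _ => outputDist_nonneg P W _
  have h1 : ∀ x, ∑ y, (if φ x y then power W x y else 0)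
      ≤ ∑ y, (if φ x y then S.multiplicity y else 0) + lam := by
    intro x
    refine (sum_ite_le_add_tvDist (p := power W x) (q := S.outputLaw x)
      (by rw [sum_power, sum_outputLaw]) (φ x)).trans (add_le_add ?_ (hS x))
    refine Finset.sum_le_sum fun y _ => ?_
    split_ifs
    · exact S.outputLaw_le_multiplicity x y
    · exact le_rfl
  have h2 : ∀ y, ∑ x : Fin n → X, (∏ i, P (x i)) * (if φ x y then 1 else 0) ≤ 1 / K := by
    intro y
    rw [le_div_iff₀ hK]
    rcases (hq0 y).eq_or_lt with h0 | hpos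
    · have hz : ∀ x : Fin n → X, (∏ i, P (x i)) * power W x y = 0 := by
        have := sum_prod_mul_power P W y
        rw [← h0, Finset.sum_eq_zero_iff_of_nonneg
          fun x _ => mul_nonneg (hP0 x) (power_nonneg W x y)] at this
        exact fun x => this x (Finset.mem_univ x)
      have : ∀ x : Fin n → X, (∏ i, P (x i)) * (if φ x y then (1 : ℝ) else 0) = 0 := by
        intro x
        split_ifs with h
        · rcases mul_eq_zero.mp (hz x) with h' | h'
          · rw [h', zero_mul]
          · exact absurd h' h.1.ne'
        · exact mul_zero _
      simp [this]
    · refine le_of_mul_le_mul_right ?_ hpos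
      rw [one_mul]
      conv_rhs => rw [← sum_prod_mul_power P W y]
      rw [mul_assoc, Finset.sum_mul]
      refine Finset.sum_le_sum fun x _ => ?_
      rw [mul_assoc]
      refine mul_le_mul_of_nonneg_left ?_ (hP0 x)
      split_ifs with h
      · rw [one_mul]; exact h.2
      · rw [zero_mul]; exact power_nonneg W x y
  calc ∑ x : Fin n → X, (∏ i, P (x i)) * ∑ y, (if φ x y then power W x y else 0)
      ≤ ∑ x : Fin n → X, (∏ i, P (x i)) *
          (∑ y, (if φ x y then S.multiplicity y else 0) + lam) :=
        Finset.sum_le_sum fun x _ => mul_le_mul_of_nonneg_left (h1 x) (hP0 x)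
    _ = lam + ∑ y, S.multiplicity y *
          ∑ x : Fin n → X, (∏ i, P (x i)) * (if φ x y then 1 else 0) := by
        simp_rw [mul_add, Finset.sum_add_distrib]
        rw [← Finset.sum_mul, hP1, one_mul, add_comm]
        simp_rw [Finset.mul_sum]
        rw [Finset.sum_comm]
        refine congrArg _ (Finset.sum_congr rfl fun y _ => Finset.sum_congr rfl fun x _ => ?_)
        split_ifs <;> ring
    _ ≤ lam + ∑ y, S.multiplicity y * (1 / K) := by
        gcongr with y
        · exact S.multiplicity_nonneg y
        · exact h2 y
    _ = lam + M / K := by rw [← Finset.sum_mul, sum_multiplicity, mul_one_div]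

open scoped Classical in
/-- At most `M * N` words are possible outputs of a code.  The words of probability at most `κ`
under `(PW)^n` therefore have total probability at most `M * N * κ` inside the set of possible
outputs, and at most `lam` outside, because the code never leaves that set. -/
theorem sum_smallProb_le [Fintype X] [Fintype Y] {W : X → stdSimplex ℝ Y} {lam : ℝ}
    (S : FeedbackCode X Y n M N) (hS : S.Simulates W lam) (P : stdSimplex ℝ X) {κ : ℝ}
    (hκ : 0 ≤ κ) :
    ∑ y : Fin n → Y, (if ∏ i, outputDist P W (y i) ≤ κ then ∏ i, outputDist P W (y i) else 0)
      ≤ lam + M * N * κ := by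
  set q : (Fin n → Y) → ℝ := fun y => ∏ i, outputDist P W (y i) with hq
  have hq0 : ∀ y, 0 ≤ q y :=
    fun y => Finset.prod_nonneg fun i _ => outputDist_nonneg P W _
  have hP0 : ∀ x : Fin n → X, 0 ≤ ∏ i, P (x i) :=
    fun x => Finset.prod_nonneg fun i _ => stdSimplex.zero_le P _
  have hP1 : ∑ x : Fin n → X, ∏ i, P (x i) = 1 :=
    sum_prod_eq_one (p := fun _ => P) fun _ => stdSimplex.sum_eq_one P
  set T : Finset (Fin n → Y) := Finset.univ.image fun a : Fin N × Fin M => S.dec a.1 a.2 with hT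
  have hTcard : (T.card : ℝ) ≤ M * N := by
    have : T.card ≤ N * M := by
      refine Finset.card_image_le.trans ?_
      simp
    calc (T.card : ℝ) ≤ ((N * M : ℕ) : ℝ) := by exact_mod_cast this
      _ = M * N := by push_cast; ring
  -- the channel leaves the set of possible outputs with probability at most `lam`
  have hmiss : ∀ x, ∑ y, (if y ∉ T then power W x y else 0) ≤ lam := by
    intro x
    refine (sum_ite_le_add_tvDist (p := power W x) (q := S.outputLaw x)
      (by rw [sum_power, sum_outputLaw]) fun y => y ∉ T).trans ?_
    have : ∑ y, (if y ∉ T then S.outputLaw x y else 0) = 0 := by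
      refine Finset.sum_eq_zero fun y _ => ?_
      by_cases hy : y ∈ T
      · exact if_neg (not_not.mpr hy)
      · rw [if_pos hy]
        refine Finset.sum_eq_zero fun ν _ => mul_eq_zero_of_right _
          (Finset.sum_eq_zero fun c _ => if_neg ?_)
        rintro rfl
        exact hy (Finset.mem_image.mpr ⟨(ν, c), Finset.mem_univ _, rfl⟩)
    rw [this, zero_add]
    exact hS x
  have hmiss' : ∑ y, (if y ∉ T then q y else 0) ≤ lam := by
    calc ∑ y, (if y ∉ T then q y else 0)
        = ∑ x : Fin n → X, (∏ i, P (x i)) * ∑ y, (if y ∉ T then power W x y else 0) := by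
          simp_rw [Finset.mul_sum]
          rw [Finset.sum_comm]
          refine Finset.sum_congr rfl fun y _ => ?_
          by_cases hy : y ∈ T
          · simp [hy]
          · simp [hy, hq, sum_prod_mul_power P W y]
      _ ≤ ∑ x : Fin n → X, (∏ i, P (x i)) * lam :=
          Finset.sum_le_sum fun x _ => mul_le_mul_of_nonneg_left (hmiss x) (hP0 x)
      _ = lam := by rw [← Finset.sum_mul, hP1, one_mul]
  have hsplit : ∀ y, (if q y ≤ κ then q y else 0)
      ≤ (if y ∉ T then q y else 0) + if y ∈ T then κ else 0 := by
    intro y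
    by_cases hy : y ∈ T <;> by_cases hk : q y ≤ κ <;> simp [hy, hk, hκ, hq0 y]
  refine (Finset.sum_le_sum fun y _ => hsplit y).trans ?_
  rw [Finset.sum_add_distrib]
  have : ∑ y, (if y ∈ T then κ else 0) = T.card * κ := by simp
  rw [this]
  gcongr

end FeedbackCode

/-- Extraction of a rate bound from a one-shot converse. -/
theorem eventually_rate_ge {lam : ℝ} (hlam : lam < 1) (v J : ℝ) {ε : ℝ} (hε : 0 < ε) :
    ∀ᶠ n : ℕ in atTop, ∀ T : ℝ, 0 < T →
      1 - v / (n * ε ^ 2) ≤ lam + T * Real.exp (-(n * (J - ε))) → J - 2 * ε ≤ Real.log T / n := by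
  have h1 : Tendsto (fun n : ℕ => v / (n * ε ^ 2)) atTop (nhds 0) :=
    tendsto_const_nhds.div_atTop
      (tendsto_natCast_atTop_atTop.atTop_mul_const (by positivity))
  have h2 : Tendsto (fun n : ℕ => Real.log ((1 - lam) / 2) / n) atTop (nhds 0) :=
    tendsto_const_nhds.div_atTop tendsto_natCast_atTop_atTop
  filter_upwards [h1.eventually_lt_const (show (0 : ℝ) < (1 - lam) / 2 by linarith),
    h2.eventually_const_lt (show -ε < 0 by linarith), eventually_gt_atTop 0]
    with n hn1 hn2 hn0 T hT h
  have hn : (0 : ℝ) < n := by exact_mod_cast hn0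
  have h3 : (1 - lam) / 2 * Real.exp (n * (J - ε)) ≤ T := by
    have h4 : (1 - lam) / 2 ≤ T * Real.exp (-(n * (J - ε))) := by linarith
    have := mul_le_mul_of_nonneg_right h4 (Real.exp_pos (n * (J - ε))).le
    rwa [mul_assoc, ← Real.exp_add, neg_add_cancel, Real.exp_zero, mul_one] at this
  have h5 := Real.log_le_log (mul_pos (by linarith) (Real.exp_pos _)) h3
  rw [Real.log_mul (by linarith) (Real.exp_pos _).ne', Real.log_exp] at h5
  rw [lt_div_iff₀ hn] at hn2
  rw [le_div_iff₀ hn]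
  nlinarith

section Converse

variable {X Y : Type*} [Fintype X] [Nonempty X] [Fintype Y]

/-- Strong converse for the communication rate, for one input distribution. -/
theorem eventually_mutualInfo_le_rate (W : X → stdSimplex ℝ Y) (P : stdSimplex ℝ X) {lam : ℝ}
    (hlam : lam < 1) {ε : ℝ} (hε : 0 < ε) :
    ∀ᶠ n : ℕ in atTop, ∀ (M N : ℕ) (S : FeedbackCode X Y n M N), S.Simulates W lam →
      mutualInfo P W - 2 * ε ≤ S.rate := by
  classical
  set p : X × Y → ℝ := fun a => P a.1 * W a.1 a.2 with hp
  set f : X × Y → ℝ := fun a => Real.log (W a.1 a.2) - Real.log (outputDist P W a.2) with hf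
  have hp0 : ∀ a, 0 ≤ p a := fun a => mul_nonneg (stdSimplex.zero_le P _) (stdSimplex.zero_le _ _)
  have hp1 : ∑ a, p a = 1 := by
    simp_rw [hp, Fintype.sum_prod_type, ← Finset.mul_sum, stdSimplex.sum_eq_one, mul_one,
      stdSimplex.sum_eq_one]
  have hmean : ∑ a, p a * f a = mutualInfo P W := by
    rw [mutualInfo_eq_sum, Fintype.sum_prod_type]
    simp_rw [hp, hf, mul_assoc, Finset.mul_sum]
  filter_upwards [eventually_rate_ge hlam (∑ a, p a * f a ^ 2) (mutualInfo P W) hε,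
    eventually_gt_atTop 0] with n hn hn0 M N S hS
  have hnpos : (0 : ℝ) < n := by exact_mod_cast hn0
  refine hn M (by exact_mod_cast S.one_le_messageCard) ?_
  set K := Real.exp (n * (mutualInfo P W - ε)) with hK
  have hch := chebyshev (ι := Fin n) (p := fun _ => p) (fun _ => hp0) (fun _ => hp1)
    (fun _ => f) (t := n * ε) (by positivity)
    (fun a => 0 < power W (fun i => (a i).1) (fun i => (a i).2) ∧
      K * ∏ i, outputDist P W (a i).2 ≤ power W (fun i => (a i).1) (fun i => (a i).2)) ?_
  · have hone := S.sum_highDensity_le hS P (Real.exp_pos (n * (mutualInfo P W - ε)))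
    rw [Real.exp_neg, ← div_eq_mul_inv]
    refine le_trans ?_ hone
    refine le_trans (le_of_eq ?_) (hch.trans (le_of_eq ?_))
    · simp only [Finset.sum_const, Finset.card_univ, Fintype.card_fin, nsmul_eq_mul]
      field_simp
    · rw [← (Equiv.arrowProdEquivProdArrow (Fin n) (fun _ => X) (fun _ => Y)).symm.sum_comp,
        Fintype.sum_prod_type]
      refine Finset.sum_congr rfl fun x _ => ?_
      rw [Finset.mul_sum]
      refine Finset.sum_congr rfl fun y _ => ?_
      simp only [Equiv.arrowProdEquivProdArrow, Equiv.coe_fn_symm_mk, hp, mul_ite, mul_zero,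
        Finset.prod_mul_distrib]
      rfl
  · intro a ha hdev
    have hW : ∀ i, 0 < W (a i).1 (a i).2 := fun i =>
      (stdSimplex.zero_le _ _).lt_of_ne' fun h => (ha i).ne' (by simp [hp, h])
    have hq : ∀ i, 0 < outputDist P W (a i).2 := fun i =>
      (ha i).trans_le (mul_le_outputDist P W _ _)
    refine ⟨Finset.prod_pos fun i _ => hW i, ?_⟩
    rw [power, hK, ← Real.log_le_log_iff
      (mul_pos (Real.exp_pos _) (Finset.prod_pos fun i _ => hq i))
      (Finset.prod_pos fun i _ => hW i), Real.log_mul (Real.exp_pos _).ne'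
      (Finset.prod_pos fun i _ => hq i).ne', Real.log_exp,
      Real.log_prod fun i _ => (hq i).ne', Real.log_prod fun i _ => (hW i).ne']
    simp only [hmean] at hdev
    simp only [hf, Finset.sum_sub_distrib, Finset.sum_const, Finset.card_univ,
      Fintype.card_fin, nsmul_eq_mul] at hdev
    linarith [(abs_lt.mp hdev).1]

/-- Strong converse for the sum of the rates, for one input distribution. -/
theorem eventually_entropy_le_rate_add_crRate (W : X → stdSimplex ℝ Y) (P : stdSimplex ℝ X)
    {lam : ℝ} (hlam : lam < 1) {ε : ℝ} (hε : 0 < ε) :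
    ∀ᶠ n : ℕ in atTop, ∀ (M N : ℕ) (S : FeedbackCode X Y n M N), S.Simulates W lam →
      entropy (outputDist P W) - 2 * ε ≤ S.rate + S.crRate := by
  classical
  set q := outputDist P W with hq
  set H := entropy q with hH
  have hmean : ∑ y, q y * Real.log (q y) = -H := by rw [hH, entropy_eq_neg_sum, neg_neg]
  filter_upwards [eventually_rate_ge hlam (∑ y, q y * Real.log (q y) ^ 2) H hε,
    eventually_gt_atTop 0] with n hn hn0 M N S hS
  have hnpos : (0 : ℝ) < n := by exact_mod_cast hn0
  have hM : (0 : ℝ) < M := by exact_mod_cast S.one_le_messageCard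
  have hN : (0 : ℝ) < N := by exact_mod_cast S.one_le_crCard
  have hrate : S.rate + S.crRate = Real.log (M * N) / n := by
    rw [Real.log_mul hM.ne' hN.ne', add_div]; rfl
  rw [hrate]
  refine hn _ (by positivity) ?_
  refine le_trans ?_ (S.sum_smallProb_le hS P (Real.exp_pos (-(n * (H - ε)))).le)
  have hch := chebyshev (ι := Fin n) (p := fun _ => q) (fun _ => outputDist_nonneg P W)
    (fun _ => sum_outputDist P W) (fun _ y => Real.log (q y)) (t := n * ε) (by positivity)
    (fun y => ∏ i, outputDist P W (y i) ≤ Real.exp (-(n * (H - ε)))) ?_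
  · refine le_trans (le_of_eq ?_) hch
    simp only [Finset.sum_const, Finset.card_univ, Fintype.card_fin, nsmul_eq_mul]
    field_simp
  · intro y hy hdev
    rw [← Real.log_le_iff_le_exp (Finset.prod_pos fun i _ => hy i),
      Real.log_prod fun i _ => (hy i).ne']
    simp only [hmean, Finset.sum_const, Finset.card_univ, Fintype.card_fin, nsmul_eq_mul] at hdev
    linarith [(abs_lt.mp hdev).2]

end Converse

/-! ### Random codebooks with likelihood encoders -/

section Codebook

variable {B : Type*} {M N : ℕ}

/-- The likelihood encoder: it chooses a message with probability proportional to the weight of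
the word that the message stands for, and uniformly if all these weights vanish. -/
noncomputable def likelihoodEncoder (w : B → ℝ) (u : Fin M → B) (c : Fin M) : ℝ :=
  if ∑ c, w (u c) = 0 then (M : ℝ)⁻¹ else w (u c) / ∑ c, w (u c)

theorem likelihoodEncoder_mem (hM : 0 < M) {w : B → ℝ} (hw : ∀ b, 0 ≤ w b) (u : Fin M → B) :
    likelihoodEncoder w u ∈ stdSimplex ℝ (Fin M) := by
  have hM' : (M : ℝ) ≠ 0 := by exact_mod_cast hM.ne'
  constructor
  · intro c
    unfold likelihoodEncoder
    split_ifs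
    · positivity
    · exact div_nonneg (hw _) (Finset.sum_nonneg fun c _ => hw _)
  · unfold likelihoodEncoder
    split_ifs with h
    · simp [hM']
    · rw [← Finset.sum_div, div_self h]

/-- Normalizing the weights costs exactly the deviation of their average from `1`. -/
theorem sum_abs_likelihoodEncoder_sub (hM : 0 < M) {w : B → ℝ} (hw : ∀ b, 0 ≤ w b)
    (u : Fin M → B) :
    ∑ c, |likelihoodEncoder w u c - w (u c) / M| = |1 - ∑ c, w (u c) / M| := by
  have hM' : (M : ℝ) ≠ 0 := by exact_mod_cast hM.ne'
  rw [← Finset.sum_div]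
  unfold likelihoodEncoder
  split_ifs with h
  · have h0 : ∀ c, w (u c) = 0 := fun c =>
      (Finset.sum_eq_zero_iff_of_nonneg fun c _ => hw _).mp h c (Finset.mem_univ c)
    simp [h0, hM']
  · have h1 : ∀ c, |w (u c) / (∑ c, w (u c)) - w (u c) / M|
        = w (u c) * |1 / (∑ c, w (u c)) - 1 / M| := by
      intro c
      rw [← abs_of_nonneg (hw (u c)), ← abs_mul, abs_of_nonneg (hw (u c))]
      congr 1
      ring
    simp_rw [h1]
    rw [← Finset.sum_mul]
    have hpos : 0 < ∑ c, w (u c) :=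
      (Finset.sum_nonneg fun c _ => hw (u c)).lt_of_ne' h
    rw [← abs_of_pos hpos, ← abs_mul, abs_of_pos hpos]
    congr 1
    field_simp

variable [DecidableEq B]

/-- The law of the output of a codebook of `N` blocks of `M` words, when the block is chosen
uniformly and the word in it by the likelihood encoder. -/
noncomputable def bookLaw (w : B → ℝ) (u : Fin N × Fin M → B) (y : B) : ℝ :=
  (N : ℝ)⁻¹ * ∑ ν, ∑ c, if u (ν, c) = y then likelihoodEncoder w (fun c => u (ν, c)) c else 0

/-- The relative frequency of `y` among the words of a codebook. -/
noncomputable def frequency (u : Fin N × Fin M → B) (y : B) : ℝ :=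
  ∑ a, if u a = y then ((N : ℝ) * M)⁻¹ else 0

theorem sum_bookLaw [Fintype B] (hN : 0 < N) (hM : 0 < M) {w : B → ℝ} (hw : ∀ b, 0 ≤ w b)
    (u : Fin N × Fin M → B) : ∑ y, bookLaw w u y = 1 := by
  have hN' : (N : ℝ) ≠ 0 := by exact_mod_cast hN.ne'
  unfold bookLaw
  rw [← Finset.mul_sum, Finset.sum_comm]
  have : ∀ ν, ∑ y, ∑ c, (if u (ν, c) = y then likelihoodEncoder w (fun c => u (ν, c)) c else 0)
      = 1 := by
    intro ν
    rw [Finset.sum_comm]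
    simpa using (likelihoodEncoder_mem hM hw fun c => u (ν, c)).2
  simp [this, hN']

theorem bookLaw_nonneg (hM : 0 < M) {w : B → ℝ} (hw : ∀ b, 0 ≤ w b)
    (u : Fin N × Fin M → B) (y : B) : 0 ≤ bookLaw w u y := by
  refine mul_nonneg (by positivity) (Finset.sum_nonneg fun ν _ => Finset.sum_nonneg fun c _ => ?_)
  split_ifs
  · exact (likelihoodEncoder_mem hM hw _).1 c
  · exact le_rfl

/-- The error of a codebook comes from three sources: the weights `w` need not reproduce the
target `v` exactly, the codebook is not perfectly distributed according to `Q`, and the weights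
in a block have to be normalized. -/
theorem sum_abs_sub_bookLaw_le [Fintype B] (hN : 0 < N) (hM : 0 < M) {w : B → ℝ}
    (hw : ∀ b, 0 ≤ w b) (v Q : B → ℝ) (u : Fin N × Fin M → B) :
    ∑ y, |v y - bookLaw w u y| ≤ ∑ y, |v y - w y * Q y| + ∑ y, w y * |frequency u y - Q y|
      + (N : ℝ)⁻¹ * ∑ ν, |1 - ∑ c, w (u (ν, c)) / M| := by
  have hN' : (N : ℝ) ≠ 0 := by exact_mod_cast hN.ne'
  have hM' : (M : ℝ) ≠ 0 := by exact_mod_cast hM.ne'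
  have hfreq : ∀ y, w y * frequency u y
      = (N : ℝ)⁻¹ * ∑ ν, ∑ c, if u (ν, c) = y then w (u (ν, c)) / M else 0 := by
    intro y
    rw [frequency, Fintype.sum_prod_type, Finset.mul_sum, Finset.mul_sum]
    refine Finset.sum_congr rfl fun ν _ => ?_
    rw [Finset.mul_sum, Finset.mul_sum]
    refine Finset.sum_congr rfl fun c _ => ?_
    split_ifs with h
    · rw [h]; field_simp
    · simp
  have hy : ∀ y, |v y - bookLaw w u y| ≤ |v y - w y * Q y| + w y * |frequency u y - Q y|
      + (N : ℝ)⁻¹ * ∑ ν, ∑ c, if u (ν, c) = y then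
        |likelihoodEncoder w (fun c => u (ν, c)) c - w (u (ν, c)) / M| else 0 := by
    intro y
    have h1 : |w y * frequency u y - bookLaw w u y| ≤ (N : ℝ)⁻¹ * ∑ ν, ∑ c,
        if u (ν, c) = y then
          |likelihoodEncoder w (fun c => u (ν, c)) c - w (u (ν, c)) / M| else 0 := by
      rw [abs_sub_comm, hfreq, bookLaw, ← mul_sub, ← Finset.sum_sub_distrib, abs_mul,
        abs_of_nonneg (by positivity : (0 : ℝ) ≤ (N : ℝ)⁻¹)]
      refine mul_le_mul_of_nonneg_left ?_ (by positivity)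
      refine (Finset.abs_sum_le_sum_abs _ _).trans (Finset.sum_le_sum fun ν _ => ?_)
      rw [← Finset.sum_sub_distrib]
      refine (Finset.abs_sum_le_sum_abs _ _).trans (Finset.sum_le_sum fun c _ => ?_)
      split_ifs <;> simp
    have h2 : w y * |frequency u y - Q y| = |w y * Q y - w y * frequency u y| := by
      rw [← mul_sub, abs_mul, abs_of_nonneg (hw y), abs_sub_comm]
    have h3 : v y - bookLaw w u y = (v y - w y * Q y) + (w y * Q y - w y * frequency u y)
        + (w y * frequency u y - bookLaw w u y) := by ring
    rw [h3, h2]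
    exact (abs_add_three _ _ _).trans (add_le_add le_rfl h1)
  refine (Finset.sum_le_sum fun y _ => hy y).trans (le_of_eq ?_)
  rw [Finset.sum_add_distrib, Finset.sum_add_distrib, ← Finset.mul_sum]
  congr 2
  rw [Finset.sum_comm]
  refine Finset.sum_congr rfl fun ν _ => ?_
  rw [← sum_abs_likelihoodEncoder_sub hM hw, Finset.sum_comm]
  simp

end Codebook

/-- The mean absolute deviation of a sum of independent random variables. -/
theorem mean_abs_sub_le {ι A : Type*} [Fintype ι] [DecidableEq ι] [Fintype A] {p : ι → A → ℝ}
    (hp0 : ∀ i a, 0 ≤ p i a) (hp : ∀ i, ∑ a, p i a = 1) (f : ι → A → ℝ) {s : ℝ} (hs : 0 < s) :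
    ∑ a : ι → A, (∏ i, p i (a i)) * |∑ i, f i (a i) - ∑ i, ∑ b, p i b * f i b|
      ≤ (s + (∑ i, ∑ b, p i b * f i b ^ 2) / s) / 2 := by
  set m := ∑ i, ∑ b, p i b * f i b
  have h0 : ∀ a : ι → A, 0 ≤ ∏ i, p i (a i) := fun a => Finset.prod_nonneg fun i _ => hp0 i _
  -- the arithmetic-geometric mean inequality, instead of Cauchy-Schwarz, avoids square roots
  have hamgm : ∀ z : ℝ, |z| ≤ (s + z ^ 2 / s) / 2 := by
    intro z
    have : 0 ≤ (|z| - s) ^ 2 / s := by positivity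
    have h : (|z| - s) ^ 2 / s = z ^ 2 / s - 2 * |z| + s := by
      rw [sub_sq, sq_abs]; field_simp
    linarith
  calc ∑ a : ι → A, (∏ i, p i (a i)) * |∑ i, f i (a i) - m|
      ≤ ∑ a : ι → A, (∏ i, p i (a i)) * ((s + (∑ i, f i (a i) - m) ^ 2 / s) / 2) :=
        Finset.sum_le_sum fun a _ => mul_le_mul_of_nonneg_left (hamgm _) (h0 a)
    _ = (s + (∑ a : ι → A, (∏ i, p i (a i)) * (∑ i, f i (a i) - m) ^ 2) / s) / 2 := by
        simp_rw [← mul_div_assoc, mul_add]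
        rw [← Finset.sum_div, Finset.sum_add_distrib, ← Finset.sum_mul, sum_prod_eq_one hp,
          one_mul, Finset.sum_div]
        simp_rw [mul_div_assoc]
    _ ≤ _ := by
        have := variance_sum_le hp f
        gcongr

/-- The expected error of a random codebook, whose words are drawn independently from `Q`.
The weights `w` stand for the likelihood ratio of the target `v` and `Q`, cut off where it is
larger than `K` or where `Q` is smaller than `1 / A`.  Blocks of `M ≫ K` words suffice for the
normalization of the weights, and `N * M ≫ A` words to approximate `Q`. -/
theorem mean_error_bookLaw_le {B : Type*} [Fintype B] [DecidableEq B] {M N : ℕ} (hN : 0 < N)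
    (hM : 0 < M) {v w Q : B → ℝ} (hv : ∑ y, v y = 1) (hQ0 : ∀ y, 0 ≤ Q y) (hQ : ∑ y, Q y = 1)
    (hw : ∀ y, 0 ≤ w y) (hwv : ∀ y, w y * Q y ≤ v y) {δ : ℝ} (hδ : 1 - δ ≤ ∑ y, w y * Q y)
    {K A : ℝ} (hA0 : 0 ≤ A) (hK : ∀ y, w y ≤ K) (hA : ∀ y, w y ≠ 0 → 1 ≤ A * Q y)
    {η : ℝ} (hη : 0 < η) :
    ∑ u : Fin N × Fin M → B, (∏ a, Q (u a)) * ∑ y, |v y - bookLaw w u y|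
      ≤ 2 * δ + η + (A / (N * M) + K / M) / (2 * η) := by
  have hN' : (0 : ℝ) < N := by exact_mod_cast hN
  have hM' : (0 : ℝ) < M := by exact_mod_cast hM
  have hρ0 : ∀ u : Fin N × Fin M → B, 0 ≤ ∏ a, Q (u a) :=
    fun u => Finset.prod_nonneg fun a _ => hQ0 _
  have hρ1 : ∑ u : Fin N × Fin M → B, ∏ a, Q (u a) = 1 :=
    sum_prod_eq_one (p := fun _ => Q) fun _ => hQ
  set m := ∑ y, w y * Q y with hm
  have hm1 : m ≤ 1 := hv ▸ Finset.sum_le_sum fun y _ => hwv y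
  have hm0 : 0 ≤ m := Finset.sum_nonneg fun y _ => mul_nonneg (hw y) (hQ0 y)
  -- the target is reproduced up to the part that has been cut off
  have h1 : ∑ y, |v y - w y * Q y| ≤ δ := by
    simp_rw [fun y => abs_of_nonneg (sub_nonneg.mpr (hwv y)), Finset.sum_sub_distrib, hv]
    linarith
  -- the empirical distribution of the codebook
  have h2 : ∀ y, w y * ∑ u : Fin N × Fin M → B, (∏ a, Q (u a)) * |frequency u y - Q y|
      ≤ w y * Q y * ((η + A / (N * M) / η) / 2) := by
    intro y
    by_cases hwy : w y = 0
    · simp [hwy]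
    have hQA := hA y hwy
    have hQy : 0 < Q y := (hQ0 y).lt_of_ne' fun h => by rw [h, mul_zero] at hQA; linarith
    rw [mul_assoc]
    refine mul_le_mul_of_nonneg_left ?_ (hw y)
    have := mean_abs_sub_le (ι := Fin N × Fin M) (p := fun _ => Q) (fun _ => hQ0) (fun _ => hQ)
      (fun _ b => if b = y then ((N : ℝ) * M)⁻¹ else 0) (s := η * Q y) (by positivity)
    have e1 : ∑ _a : Fin N × Fin M, ∑ b, Q b * (if b = y then ((N : ℝ) * M)⁻¹ else 0) = Q y := by
      simp
      field_simp
    have e2 : ∑ _a : Fin N × Fin M, ∑ b, Q b * (if b = y then ((N : ℝ) * M)⁻¹ else 0) ^ 2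
        = Q y / (N * M) := by
      simp [ite_pow]
      field_simp
    rw [e1, e2] at this
    refine this.trans ?_
    have h3 : Q y / (N * M) / (η * Q y) = 1 / (N * M) / η := by field_simp
    have h4 : 1 / ((N : ℝ) * M) / η ≤ A * Q y / (N * M) / η := by gcongr
    rw [h3]
    calc (η * Q y + 1 / (N * M) / η) / 2 ≤ (η * Q y + A * Q y / (N * M) / η) / 2 := by linarith
      _ = Q y * ((η + A / (N * M) / η) / 2) := by ring
  -- the normalization of the weights in one block
  have h3 : ∀ ν : Fin N, ∑ u : Fin N × Fin M → B, (∏ a, Q (u a)) *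
      |1 - ∑ c, w (u (ν, c)) / M| ≤ δ + (η + K / M / η) / 2 := by
    intro ν
    have := mean_abs_sub_le (ι := Fin N × Fin M) (p := fun _ => Q) (fun _ => hQ0) (fun _ => hQ)
      (fun a b => if a.1 = ν then w b / M else 0) hη
    have e0 : ∀ u : Fin N × Fin M → B, ∑ a, (if a.1 = ν then w (u a) / M else 0)
        = ∑ c, w (u (ν, c)) / M := by
      intro u
      rw [Fintype.sum_prod_type, Finset.sum_eq_single ν] <;> simp +contextual
    have e1 : ∑ a : Fin N × Fin M, ∑ b, Q b * (if a.1 = ν then w b / M else 0) = m := by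
      rw [Fintype.sum_prod_type, Finset.sum_eq_single ν]
      · simp only [if_true, Finset.sum_const, Finset.card_univ, Fintype.card_fin, nsmul_eq_mul,
          hm, Finset.mul_sum]
        refine Finset.sum_congr rfl fun b _ => ?_
        field_simp
      · simp +contextual
      · simp
    have e2 : ∑ a : Fin N × Fin M, ∑ b, Q b * (if a.1 = ν then w b / M else 0) ^ 2 ≤ K / M := by
      rw [Fintype.sum_prod_type, Finset.sum_eq_single ν]
      · simp only [if_true, Finset.sum_const, Finset.card_univ, Fintype.card_fin, nsmul_eq_mul]
        have hb : ∀ b, Q b * (w b / M) ^ 2 ≤ w b * Q b * (K / M ^ 2) := by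
          intro b
          have := mul_le_mul_of_nonneg_left (hK b) (mul_nonneg (hw b) (hQ0 b))
          calc Q b * (w b / M) ^ 2 = w b * Q b * w b / M ^ 2 := by ring
            _ ≤ w b * Q b * K / M ^ 2 := by gcongr
            _ = _ := by ring
        have hK0 : 0 ≤ K := by
          by_contra hneg
          obtain ⟨y⟩ : Nonempty B := by
            by_contra hB
            rw [not_nonempty_iff] at hB
            simp at hQ
          exact hneg ((hw y).trans (hK y))
        calc (M : ℝ) * ∑ b, Q b * (w b / M) ^ 2 ≤ M * ∑ b, w b * Q b * (K / M ^ 2) := by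
              exact mul_le_mul_of_nonneg_left (Finset.sum_le_sum fun b _ => hb b) hM'.le
          _ = m * (K / M) := by rw [← Finset.sum_mul, ← hm]; field_simp
          _ ≤ 1 * (K / M) := by gcongr
          _ = K / M := one_mul _
      · simp +contextual
      · simp
    simp_rw [e0, e1] at this
    have hu : ∀ u : Fin N × Fin M → B, (∏ a, Q (u a)) * |1 - ∑ c, w (u (ν, c)) / M|
        ≤ (∏ a, Q (u a)) * δ + (∏ a, Q (u a)) * |∑ c, w (u (ν, c)) / M - m| := by
      intro u
      rw [← mul_add]
      refine mul_le_mul_of_nonneg_left ?_ (hρ0 u)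
      rw [abs_sub_comm (∑ c, w (u (ν, c)) / M) m]
      have := abs_sub_le 1 m (∑ c, w (u (ν, c)) / M)
      rw [abs_of_nonneg (sub_nonneg.mpr hm1)] at this
      linarith
    refine (Finset.sum_le_sum fun u _ => hu u).trans ?_
    rw [Finset.sum_add_distrib, ← Finset.sum_mul, hρ1, one_mul]
    have h5 : (η + (∑ a : Fin N × Fin M, ∑ b, Q b * (if a.1 = ν then w b / M else 0) ^ 2) / η) / 2
        ≤ (η + K / M / η) / 2 := by gcongr
    linarith
  calc ∑ u : Fin N × Fin M → B, (∏ a, Q (u a)) * ∑ y, |v y - bookLaw w u y|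
      ≤ ∑ u : Fin N × Fin M → B, (∏ a, Q (u a)) *
          (∑ y, |v y - w y * Q y| + ∑ y, w y * |frequency u y - Q y|
            + (N : ℝ)⁻¹ * ∑ ν, |1 - ∑ c, w (u (ν, c)) / M|) :=
        Finset.sum_le_sum fun u _ => mul_le_mul_of_nonneg_left
          (sum_abs_sub_bookLaw_le hN hM hw v Q u) (hρ0 u)
    _ = ∑ y, |v y - w y * Q y|
          + ∑ y, w y * ∑ u : Fin N × Fin M → B, (∏ a, Q (u a)) * |frequency u y - Q y|
          + (N : ℝ)⁻¹ * ∑ ν, ∑ u : Fin N × Fin M → B, (∏ a, Q (u a)) *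
              |1 - ∑ c, w (u (ν, c)) / M| := by
        simp_rw [mul_add, Finset.sum_add_distrib]
        rw [← Finset.sum_mul, hρ1, one_mul]
        simp_rw [Finset.mul_sum]
        rw [Finset.sum_comm (s := (Finset.univ : Finset B))]
        rw [Finset.sum_comm (s := (Finset.univ : Finset (Fin N)))]
        congr 1
        · congr 1
          exact Finset.sum_congr rfl fun u _ => Finset.sum_congr rfl fun y _ => by ring
        · exact Finset.sum_congr rfl fun u _ => Finset.sum_congr rfl fun y _ => by ring
    _ ≤ δ + ∑ y, w y * Q y * ((η + A / (N * M) / η) / 2)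
          + (N : ℝ)⁻¹ * ∑ _ν : Fin N, (δ + (η + K / M / η) / 2) := by
        refine add_le_add (add_le_add h1 (Finset.sum_le_sum fun y _ => h2 y)) ?_
        exact mul_le_mul_of_nonneg_left (Finset.sum_le_sum fun ν _ => h3 ν) (by positivity)
    _ = δ + m * ((η + A / (N * M) / η) / 2) + (δ + (η + K / M / η) / 2) := by
        rw [← Finset.sum_mul, Finset.sum_const, Finset.card_univ, Fintype.card_fin, nsmul_eq_mul,
          inv_mul_cancel_left₀ hN'.ne']
    _ ≤ δ + 1 * ((η + A / (N * M) / η) / 2) + (δ + (η + K / M / η) / 2) := by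
        gcongr
    _ = _ := by field_simp; ring

/-! ### Few codebooks that are good for every input -/

theorem exists_le_of_mean_le {Ω : Type*} [Fintype Ω] {ρ : Ω → ℝ} (hρ0 : ∀ ω, 0 ≤ ρ ω)
    (hρ1 : ∑ ω, ρ ω = 1) {F : Ω → ℝ} {c : ℝ} (hF : ∑ ω, ρ ω * F ω ≤ c) : ∃ ω, F ω ≤ c := by
  by_contra! h
  have h1 : ∑ ω, ρ ω * (F ω - c) ≤ 0 := by
    simp_rw [mul_sub, Finset.sum_sub_distrib, ← Finset.sum_mul, hρ1]
    linarith
  have h2 : ∀ ω ∈ Finset.univ, 0 ≤ ρ ω * (F ω - c) :=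
    fun ω _ => mul_nonneg (hρ0 ω) (sub_nonneg.mpr (h ω).le)
  have h3 := (Finset.sum_eq_zero_iff_of_nonneg h2).mp (le_antisymm h1 (Finset.sum_nonneg h2))
  have h4 : ∀ ω, ρ ω = 0 := fun ω =>
    (mul_eq_zero.mp (h3 ω (Finset.mem_univ ω))).resolve_right (sub_pos.mpr (h ω)).ne'
  simp [h4] at hρ1

/-- If a random choice has small expected error for each input, then there is a short list of
choices whose average error is small for all inputs simultaneously.  The list is built
greedily, so that the potential `∑ x, ∏ l, (1 + err x (ω l))` grows slowly. -/
theorem exists_list_sum_err_le {I Ω : Type*} [Fintype I] [Fintype Ω] {ρ : Ω → ℝ}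
    (hρ0 : ∀ ω, 0 ≤ ρ ω) (hρ1 : ∑ ω, ρ ω = 1) {err : I → Ω → ℝ} (herr0 : ∀ x ω, 0 ≤ err x ω)
    (herr1 : ∀ x ω, err x ω ≤ 1) {δ : ℝ} (hδ0 : 0 ≤ δ)
    (hδ : ∀ x, ∑ ω, ρ ω * err x ω ≤ δ) (L : ℕ) :
    ∃ ω : Fin L → Ω, ∀ x, (∑ l, err x (ω l)) * Real.log 2
      ≤ Real.log (Fintype.card I) + L * δ := by
  have hpot : ∃ ω : Fin L → Ω, ∑ x, ∏ l, (1 + err x (ω l)) ≤ Fintype.card I * (1 + δ) ^ L := by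
    induction L with
    | zero => exact ⟨Fin.elim0, by simp⟩
    | succ L ih =>
      obtain ⟨ω, hω⟩ := ih
      have hprod : ∀ x, 0 ≤ ∏ l, (1 + err x (ω l)) :=
        fun x => Finset.prod_nonneg fun l _ => by linarith [herr0 x (ω l)]
      obtain ⟨ω', hω'⟩ := exists_le_of_mean_le hρ0 hρ1
        (F := fun ω' => ∑ x, (1 + err x ω') * ∏ l, (1 + err x (ω l)))
        (c := (1 + δ) * ∑ x, ∏ l, (1 + err x (ω l))) (by
          simp_rw [Finset.mul_sum]
          rw [Finset.sum_comm]
          refine Finset.sum_le_sum fun x _ => ?_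
          simp_rw [← mul_assoc]
          rw [← Finset.sum_mul]
          refine mul_le_mul_of_nonneg_right ?_ (hprod x)
          simp_rw [mul_add, mul_one, Finset.sum_add_distrib, hρ1]
          linarith [hδ x])
      refine ⟨Fin.cons ω' ω, ?_⟩
      simp_rw [Fin.prod_univ_succ, Fin.cons_zero, Fin.cons_succ]
      refine hω'.trans ?_
      rw [pow_succ]
      have := mul_le_mul_of_nonneg_left hω (show 0 ≤ 1 + δ by linarith)
      linarith
  obtain ⟨ω, hω⟩ := hpot
  refine ⟨ω, fun x => ?_⟩
  have hpos : ∀ x l, 0 < 1 + err x (ω l) := fun x l => by linarith [herr0 x (ω l)]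
  have h1 : ∏ l, (1 + err x (ω l)) ≤ Fintype.card I * (1 + δ) ^ L :=
    (Finset.single_le_sum (f := fun x => ∏ l, (1 + err x (ω l)))
      (fun x _ => Finset.prod_nonneg fun l _ => (hpos x l).le) (Finset.mem_univ x)).trans hω
  have hcard : (0 : ℝ) < Fintype.card I := by
    exact_mod_cast Fintype.card_pos_iff.mpr ⟨x⟩
  have h2 := Real.log_le_log (Finset.prod_pos fun l _ => hpos x l) h1
  rw [Real.log_prod fun l _ => (hpos x l).ne', Real.log_mul hcard.ne' (by positivity),
    Real.log_pow] at h2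
  have h3 : Real.log (1 + δ) ≤ δ := by
    linarith [Real.log_le_sub_one_of_pos (x := 1 + δ) (by linarith)]
  -- convexity: `2 ^ t ≤ 1 + t` for `t` in the unit interval
  have h4 : ∀ l, err x (ω l) * Real.log 2 ≤ Real.log (1 + err x (ω l)) := by
    intro l
    rw [← Real.log_rpow two_pos]
    refine Real.log_le_log (by positivity) ?_
    have := rpow_one_add_le_one_add_mul_self (s := 1) (by norm_num) (herr0 x (ω l))
      (herr1 x (ω l))
    norm_num at this
    exact this
  rw [Finset.sum_mul]
  refine (Finset.sum_le_sum fun l _ => h4 l).trans (h2.trans ?_)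
  gcongr

theorem tvDist_nonneg {A : Type*} [Fintype A] (p q : A → ℝ) : 0 ≤ tvDist p q :=
  mul_nonneg (by norm_num) (Finset.sum_nonneg fun _ _ => abs_nonneg _)

theorem tvDist_le_one {A : Type*} [Fintype A] {p q : A → ℝ} (hp0 : ∀ a, 0 ≤ p a)
    (hp : ∑ a, p a = 1) (hq0 : ∀ a, 0 ≤ q a) (hq : ∑ a, q a = 1) : tvDist p q ≤ 1 := by
  have : ∑ a, |p a - q a| ≤ ∑ a, (p a + q a) :=
    Finset.sum_le_sum fun a _ => abs_le.mpr ⟨by linarith [hp0 a], by linarith [hq0 a]⟩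
  rw [Finset.sum_add_distrib, hp, hq] at this
  unfold tvDist
  linarith

theorem tvDist_average_le {A : Type*} [Fintype A] {L : ℕ} (hL : 0 < L) (p : A → ℝ)
    (q : Fin L → A → ℝ) :
    tvDist p (fun a => (L : ℝ)⁻¹ * ∑ l, q l a) ≤ (L : ℝ)⁻¹ * ∑ l, tvDist p (q l) := by
  have hL' : (L : ℝ) ≠ 0 := by exact_mod_cast hL.ne'
  have h : ∀ a, |p a - (L : ℝ)⁻¹ * ∑ l, q l a| ≤ (L : ℝ)⁻¹ * ∑ l, |p a - q l a| := by
    intro a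
    have : p a - (L : ℝ)⁻¹ * ∑ l, q l a = (L : ℝ)⁻¹ * ∑ l, (p a - q l a) := by
      simp [Finset.sum_sub_distrib, mul_sub, hL']
    rw [this, abs_mul, abs_of_nonneg (by positivity : (0 : ℝ) ≤ (L : ℝ)⁻¹)]
    gcongr
    exact Finset.abs_sum_le_sum_abs _ _
  unfold tvDist
  rw [← Finset.mul_sum, Finset.sum_comm, mul_left_comm, Finset.mul_sum (a := (L : ℝ)⁻¹)]
  gcongr with a
  exact h a

section Code

variable {X Y : Type*} [DecidableEq Y] {n M N L : ℕ}

/-- The code that uses `L` codebooks: the common randomness chooses one of the books and one of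
its blocks, and the sender applies the likelihood encoder with weights depending on the input. -/
noncomputable def codeOfBooks (hM : 0 < M) (hN : 0 < N) (hL : 0 < L)
    {w : (Fin n → X) → (Fin n → Y) → ℝ} (hw : ∀ x y, 0 ≤ w x y)
    (u : Fin L → Fin N × Fin M → Fin n → Y) : FeedbackCode X Y n M (L * N) where
  cr := ⟨fun _ => ((L * N : ℕ) : ℝ)⁻¹, fun _ => by positivity, by
    have : ((L * N : ℕ) : ℝ) ≠ 0 := by exact_mod_cast (Nat.mul_pos hL hN).ne'
    rw [Finset.sum_const, Finset.card_univ, Fintype.card_fin, nsmul_eq_mul, mul_inv_cancel₀ this]⟩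
  enc k x := ⟨likelihoodEncoder (w x) fun c =>
      u (finProdFinEquiv.symm k).1 ((finProdFinEquiv.symm k).2, c),
    likelihoodEncoder_mem hM (hw x) _⟩
  dec k c := u (finProdFinEquiv.symm k).1 ((finProdFinEquiv.symm k).2, c)

theorem outputLaw_codeOfBooks (hM : 0 < M) (hN : 0 < N) (hL : 0 < L)
    {w : (Fin n → X) → (Fin n → Y) → ℝ} (hw : ∀ x y, 0 ≤ w x y)
    (u : Fin L → Fin N × Fin M → Fin n → Y) (x : Fin n → X) :
    (codeOfBooks hM hN hL hw u).outputLaw x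
      = fun y => (L : ℝ)⁻¹ * ∑ l, bookLaw (w x) (u l) y := by
  classical
  funext y
  unfold FeedbackCode.outputLaw bookLaw
  rw [← finProdFinEquiv.sum_comp, Fintype.sum_prod_type, Finset.mul_sum]
  refine Finset.sum_congr rfl fun l _ => ?_
  rw [Finset.mul_sum, Finset.mul_sum]
  refine Finset.sum_congr rfl fun ν _ => ?_
  have h1 : (codeOfBooks hM hN hL hw u).cr (finProdFinEquiv (l, ν)) = ((L * N : ℕ) : ℝ)⁻¹ := rfl
  rw [h1, Nat.cast_mul, mul_inv, mul_assoc]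
  refine congrArg _ (congrArg _ (Finset.sum_congr rfl fun c _ => ?_))
  have h2 : (codeOfBooks hM hN hL hw u).dec (finProdFinEquiv (l, ν)) c = u l (ν, c) := by
    change u (finProdFinEquiv.symm _).1 ((finProdFinEquiv.symm _).2, c) = _
    rw [Equiv.symm_apply_apply]
  have h3 : (codeOfBooks hM hN hL hw u).enc (finProdFinEquiv (l, ν)) x c
      = likelihoodEncoder (w x) (fun c => u l (ν, c)) c := by
    change likelihoodEncoder _ _ _ = _
    simp
  rw [h2, h3]
  congr 1

/-- One-shot achievability for the whole block: codebooks with small expected error yield a code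
whose error is small for every input word. -/
theorem exists_code [Fintype X] [Fintype Y] (W : X → stdSimplex ℝ Y) (hM : 0 < M) (hN : 0 < N)
    (hL : 0 < L) {w : (Fin n → X) → (Fin n → Y) → ℝ} (hw : ∀ x y, 0 ≤ w x y)
    {Q : (Fin n → Y) → ℝ} (hQ0 : ∀ y, 0 ≤ Q y) (hQ : ∑ y, Q y = 1) {δ : ℝ} (hδ0 : 0 ≤ δ)
    (hδ : ∀ x, ∑ u : Fin N × Fin M → Fin n → Y, (∏ a, Q (u a)) *
      ∑ y, |power W x y - bookLaw (w x) u y| ≤ 2 * δ) :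
    ∃ S : FeedbackCode X Y n M (L * N), S.IsUniform ∧
      S.Simulates W (2 * (n * Real.log (Fintype.card X) / L + δ)) := by
  have hL' : (0 : ℝ) < L := by exact_mod_cast hL
  obtain ⟨u, hu⟩ := exists_list_sum_err_le
    (ρ := fun u : Fin N × Fin M → Fin n → Y => ∏ a, Q (u a))
    (fun u => Finset.prod_nonneg fun a _ => hQ0 _)
    (sum_prod_eq_one (p := fun _ => Q) fun _ => hQ)
    (err := fun (x : Fin n → X) u => tvDist (power W x) (bookLaw (w x) u))
    (fun x u => tvDist_nonneg _ _)
    (fun x u => tvDist_le_one (power_nonneg W x) (sum_power W x) (bookLaw_nonneg hM (hw x) u)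
      (sum_bookLaw hN hM (hw x) u)) hδ0
    (fun x => by
      unfold tvDist
      simp_rw [mul_left_comm _ (2⁻¹ : ℝ)]
      rw [← Finset.mul_sum]
      linarith [hδ x]) L
  refine ⟨codeOfBooks hM hN hL hw u, fun _ => rfl, fun x => ?_⟩
  rw [outputLaw_codeOfBooks]
  refine (tvDist_average_le hL _ _).trans ?_
  have hux := hu x
  have hlog2 : (1 : ℝ) / 2 ≤ Real.log 2 := by linarith [Real.log_two_gt_d9]
  rw [Fintype.card_fun, Fintype.card_fin, Nat.cast_pow, Real.log_pow] at hux
  set s := ∑ l, tvDist (power W x) (bookLaw (w x) (u l))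
  have hs : 0 ≤ s := Finset.sum_nonneg fun l _ => tvDist_nonneg _ _
  have h1 : s ≤ 2 * (n * Real.log (Fintype.card X) + L * δ) := by nlinarith
  rw [inv_mul_le_iff₀ hL']
  refine h1.trans (le_of_eq ?_)
  field_simp

end Code

/-! ### Existence of the maxima -/

section Maxima

variable {X Y : Type*} [Fintype X] [Fintype Y]

theorem continuous_outputDist (W : X → stdSimplex ℝ Y) (y : Y) :
    Continuous fun P : stdSimplex ℝ X => outputDist P W y :=
  continuous_finsetSum _ fun x _ =>
    ((continuous_apply x).comp continuous_subtype_val).mul continuous_const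

theorem continuous_entropy_outputDist (W : X → stdSimplex ℝ Y) :
    Continuous fun P : stdSimplex ℝ X => entropy (outputDist P W) :=
  continuous_finsetSum _ fun y _ =>
    Real.continuous_negMulLog.comp (continuous_outputDist W y)

theorem continuous_mutualInfo (W : X → stdSimplex ℝ Y) :
    Continuous fun P : stdSimplex ℝ X => mutualInfo P W :=
  (continuous_entropy_outputDist W).sub <| continuous_finsetSum _ fun x _ =>
    ((continuous_apply x).comp continuous_subtype_val).mul continuous_const

variable [Nonempty X]

theorem isGreatest_capacity (W : X → stdSimplex ℝ Y) :
    IsGreatest (Set.range fun P : stdSimplex ℝ X => mutualInfo P W) (capacity W) :=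
  (isCompact_range (continuous_mutualInfo W)).isGreatest_sSup (Set.range_nonempty _)

theorem capacity_nonneg (W : X → stdSimplex ℝ Y) : 0 ≤ capacity W := by
  classical
  -- a constant input has mutual information `0`
  obtain ⟨x⟩ := ‹Nonempty X›
  set P : stdSimplex ℝ X := ⟨Pi.single x 1, single_mem_stdSimplex ℝ x⟩
  have hP : ∀ a, P a = if a = x then 1 else 0 := fun a => Pi.single_apply x 1 a
  refine le_trans (le_of_eq ?_) ((isGreatest_capacity W).2 ⟨P, rfl⟩)
  have hout : outputDist P W = W x := by
    funext y
    simp [outputDist, hP]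
  simp [mutualInfo, hout, hP]

theorem isGreatest_maxOutputEntropy (W : X → stdSimplex ℝ Y) :
    IsGreatest (Set.range fun P : stdSimplex ℝ X => entropy (outputDist P W))
      (maxOutputEntropy W) :=
  (isCompact_range (continuous_entropy_outputDist W)).isGreatest_sSup (Set.range_nonempty _)

end Maxima

/-! ### Empirical distributions and typical outputs -/

theorem mul_log_sq_le_two {p : ℝ} (hp0 : 0 ≤ p) (hp1 : p ≤ 1) : p * Real.log p ^ 2 ≤ 2 := by
  rcases hp0.eq_or_lt with rfl | hp
  · simp
  have h := Real.quadratic_le_exp_of_nonneg (x := -Real.log p)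
    (neg_nonneg.mpr (Real.log_nonpos hp0 hp1))
  rw [Real.exp_neg, Real.exp_log hp] at h
  have h1 : Real.log p ^ 2 / 2 ≤ p⁻¹ := by nlinarith [Real.log_nonpos hp0 hp1]
  have h2 := mul_le_mul_of_nonneg_left h1 hp0
  rw [mul_inv_cancel₀ hp.ne'] at h2
  linarith

theorem sum_mul_log_sq_le {Y : Type*} [Fintype Y] {q : Y → ℝ} (hq0 : ∀ y, 0 ≤ q y)
    (hq : ∑ y, q y = 1) :
    ∑ y, q y * Real.log (q y) ^ 2 ≤ 2 * Fintype.card Y := by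
  calc ∑ y, q y * Real.log (q y) ^ 2 ≤ ∑ _y : Y, (2 : ℝ) :=
        Finset.sum_le_sum fun y _ => mul_log_sq_le_two (hq0 y)
          (hq ▸ Finset.single_le_sum (fun y _ => hq0 y) (Finset.mem_univ y))
    _ = 2 * Fintype.card Y := by simp [mul_comm]

section Types

variable {X Y : Type*} [Fintype X] [DecidableEq X] [Fintype Y] {n : ℕ}

/-- The empirical distribution of a nonempty word. -/
noncomputable def empiricalDist (hn : 0 < n) (x : Fin n → X) : stdSimplex ℝ X :=
  ⟨fun a => (n : ℝ)⁻¹ * (Finset.univ.filter fun i => x i = a).card, fun a => by positivity, by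
    have hn' : (n : ℝ) ≠ 0 := by exact_mod_cast hn.ne'
    rw [← Finset.mul_sum, ← Nat.cast_sum,
      ← Finset.card_eq_sum_card_fiberwise (fun _ _ => Finset.mem_coe.mpr (Finset.mem_univ _)),
      Finset.card_univ, Fintype.card_fin, inv_mul_cancel₀ hn']⟩

theorem sum_comp_eq_empiricalDist (hn : 0 < n) (x : Fin n → X) (f : X → ℝ) :
    ∑ i, f (x i) = n * ∑ a, empiricalDist hn x a * f a := by
  have hn' : (n : ℝ) ≠ 0 := by exact_mod_cast hn.ne'
  have h : ∀ a, empiricalDist hn x a = (n : ℝ)⁻¹ * (Finset.univ.filter fun i => x i = a).card :=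
    fun _ => rfl
  simp_rw [h, mul_assoc, ← Finset.mul_sum]
  rw [mul_inv_cancel_left₀ hn', ← Finset.sum_fiberwise_of_maps_to (g := x)
    (fun _ _ => Finset.mem_univ _)]
  refine Finset.sum_congr rfl fun a _ => ?_
  rw [Finset.sum_congr rfl fun i hi => congrArg f (Finset.mem_filter.mp hi).2, Finset.sum_const,
    nsmul_eq_mul]

/-- A single distribution on words that dominates, up to a polynomial factor, the i.i.d. output
distributions of all empirical input distributions.  It is their uniform mixture, the index
running over all candidates for the vector of letter counts. -/
theorem exists_universal_dist [Nonempty X] (W : X → stdSimplex ℝ Y) (hn : 0 < n) :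
    ∃ Q : (Fin n → Y) → ℝ, (∀ y, 0 ≤ Q y) ∧ ∑ y, Q y = 1 ∧ ∀ (x : Fin n → X) y,
      ∏ i, outputDist (empiricalDist hn x) W (y i) ≤ (n + 1 : ℝ) ^ Fintype.card X * Q y := by
  set count : (Fin n → X) → X → Fin (n + 1) := fun x a =>
    ⟨(Finset.univ.filter fun i => x i = a).card,
      Nat.lt_succ_of_le ((Finset.card_filter_le _ _).trans (by simp))⟩ with hcount
  set q : (Fin n → X) → (Fin n → Y) → ℝ :=
    fun x y => ∏ i, outputDist (empiricalDist hn x) W (y i) with hq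
  have hq0 : ∀ x y, 0 ≤ q x y :=
    fun x y => Finset.prod_nonneg fun i _ => outputDist_nonneg _ W _
  have hq1 : ∀ x, ∑ y, q x y = 1 := fun x =>
    sum_prod_eq_one (p := fun _ => outputDist (empiricalDist hn x) W) fun _ => sum_outputDist _ W
  have hcongr : ∀ x, q (Function.invFun count (count x)) = q x := by
    intro x
    have h : count (Function.invFun count (count x)) = count x :=
      Function.invFun_eq ⟨x, rfl⟩
    have h' : empiricalDist hn (Function.invFun count (count x)) = empiricalDist hn x := by
      apply Subtype.ext
      funext a
      have := congrArg Fin.val (congrFun h a)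
      simp only [hcount] at this
      change (n : ℝ)⁻¹ * _ = (n : ℝ)⁻¹ * _
      rw [this]
    simp only [hq, h']
  have hc : (0 : ℝ) < (n + 1 : ℝ) ^ Fintype.card X := by positivity
  have hcard : (Fintype.card (X → Fin (n + 1)) : ℝ) = (n + 1 : ℝ) ^ Fintype.card X := by
    simp
  refine ⟨fun y => ((n + 1 : ℝ) ^ Fintype.card X)⁻¹ *
    ∑ t : X → Fin (n + 1), q (Function.invFun count t) y, fun y => ?_, ?_, fun x y => ?_⟩
  · exact mul_nonneg (inv_nonneg.mpr hc.le) (Finset.sum_nonneg fun t _ => hq0 _ y)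
  · rw [← Finset.mul_sum, Finset.sum_comm]
    simp_rw [hq1]
    rw [Finset.sum_const, Finset.card_univ, nsmul_eq_mul, mul_one, hcard, inv_mul_cancel₀ hc.ne']
  · rw [mul_inv_cancel_left₀ hc.ne']
    refine le_trans (le_of_eq ?_) (Finset.single_le_sum
      (f := fun t => q (Function.invFun count t) y) (fun t _ => hq0 _ y)
      (Finset.mem_univ (count x)))
    exact (congrFun (hcongr x) y).symm

/-- The output `y` is typical for the input `x`: with `P` the empirical distribution of `x`, it
has under `(PW)^n` at least about the probability `exp (-n H(PW))`, and its likelihood ratio is at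
most about `exp (n I(P;W))`. -/
def IsTypical (W : X → stdSimplex ℝ Y) (hn : 0 < n) (ε : ℝ) (x : Fin n → X)
    (y : Fin n → Y) : Prop :=
  Real.exp (-(n * (entropy (outputDist (empiricalDist hn x) W) + ε)))
      ≤ ∏ i, outputDist (empiricalDist hn x) W (y i) ∧
    power W x y ≤ Real.exp (n * (mutualInfo (empiricalDist hn x) W + ε))
      * ∏ i, outputDist (empiricalDist hn x) W (y i)

open scoped Classical in
theorem prob_isTypical_ge (W : X → stdSimplex ℝ Y) (hn : 0 < n) {ε : ℝ} (hε : 0 < ε)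
    (x : Fin n → X) :
    1 - 10 * Fintype.card Y / (n * ε ^ 2)
      ≤ ∑ y, if IsTypical W hn ε x y then power W x y else 0 := by
  have hn' : (0 : ℝ) < n := by exact_mod_cast hn
  set P := empiricalDist hn x with hP
  set q := outputDist P W with hq
  have hp0 : ∀ i y, 0 ≤ W (x i) y := fun i y => stdSimplex.zero_le _ _
  have hp1 : ∀ i, ∑ y, W (x i) y = 1 := fun i => stdSimplex.sum_eq_one _
  have hmean : ∀ f : X → Y → ℝ, ∑ i, ∑ y, W (x i) y * f (x i) y
      = n * ∑ a, P a * ∑ y, W a y * f a y := fun f =>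
    sum_comp_eq_empiricalDist hn x fun a => ∑ y, W a y * f a y
  have hqpos : ∀ y : Fin n → Y, (∀ i, 0 < W (x i) (y i)) → ∀ i, 0 < q (y i) := by
    intro y hy i
    refine lt_of_lt_of_le (mul_pos ?_ (hy i)) (mul_le_outputDist P W (x i) (y i))
    change 0 < (n : ℝ)⁻¹ * _
    have : 0 < (Finset.univ.filter fun j => x j = x i).card :=
      Finset.card_pos.mpr ⟨i, by simp⟩
    positivity
  have hqsq : ∑ i, ∑ y, W (x i) y * Real.log (q y) ^ 2 ≤ n * (2 * Fintype.card Y) := by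
    rw [hmean fun _ y => Real.log (q y) ^ 2, ← sum_outputDist_mul]
    gcongr
    exact sum_mul_log_sq_le (outputDist_nonneg P W) (sum_outputDist P W)
  have hWsq : ∑ i, ∑ y, W (x i) y * Real.log (W (x i) y) ^ 2 ≤ n * (2 * Fintype.card Y) := by
    calc ∑ i, ∑ y, W (x i) y * Real.log (W (x i) y) ^ 2
        ≤ ∑ _i : Fin n, (2 * Fintype.card Y : ℝ) :=
          Finset.sum_le_sum fun i _ => sum_mul_log_sq_le (hp0 i) (hp1 i)
      _ = n * (2 * Fintype.card Y) := by simp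
  have hent : 1 - 2 * Fintype.card Y / (n * ε ^ 2) ≤ ∑ y : Fin n → Y,
      if Real.exp (-(n * (entropy q + ε))) ≤ ∏ i, q (y i) then power W x y else 0 := by
    refine le_trans ?_ (chebyshev (p := fun i => W (x i)) hp0 hp1 (fun _ y => Real.log (q y))
      (t := n * ε) (by positivity)
      (fun y => Real.exp (-(n * (entropy q + ε))) ≤ ∏ i, q (y i)) ?_)
    · have h : (∑ i, ∑ y, W (x i) y * Real.log (q y) ^ 2) / (n * ε) ^ 2
          ≤ n * (2 * Fintype.card Y) / (n * ε) ^ 2 := by gcongr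
      have h' : n * (2 * Fintype.card Y) / (n * ε) ^ 2
          = 2 * Fintype.card Y / (n * ε ^ 2) := by field_simp
      linarith
    · intro y hy hdev
      rw [← Real.le_log_iff_exp_le (Finset.prod_pos fun i _ => hqpos y hy i),
        Real.log_prod fun i _ => (hqpos y hy i).ne']
      rw [hmean fun _ y => Real.log (q y), ← sum_outputDist_mul, ← hq] at hdev
      rw [entropy_eq_neg_sum]
      linarith [(abs_lt.mp hdev).1]
  have hinf : 1 - 8 * Fintype.card Y / (n * ε ^ 2) ≤ ∑ y : Fin n → Y,
      if power W x y ≤ Real.exp (n * (mutualInfo P W + ε)) * ∏ i, q (y i)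
        then power W x y else 0 := by
    refine le_trans ?_ (chebyshev (p := fun i => W (x i)) hp0 hp1
      (fun i y => Real.log (W (x i) y) - Real.log (q y)) (t := n * ε) (by positivity)
      (fun y => power W x y ≤ Real.exp (n * (mutualInfo P W + ε)) * ∏ i, q (y i)) ?_)
    · have hsq : ∑ i, ∑ y, W (x i) y * (Real.log (W (x i) y) - Real.log (q y)) ^ 2
          ≤ n * (8 * Fintype.card Y) := by
        have : ∀ i y, W (x i) y * (Real.log (W (x i) y) - Real.log (q y)) ^ 2
            ≤ 2 * (W (x i) y * Real.log (W (x i) y) ^ 2)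
              + 2 * (W (x i) y * Real.log (q y) ^ 2) := by
          intro i y
          have := mul_le_mul_of_nonneg_left
            (show (Real.log (W (x i) y) - Real.log (q y)) ^ 2
              ≤ 2 * Real.log (W (x i) y) ^ 2 + 2 * Real.log (q y) ^ 2 by
              nlinarith [sq_nonneg (Real.log (W (x i) y) + Real.log (q y))]) (hp0 i y)
          linarith
        refine (Finset.sum_le_sum fun i _ => Finset.sum_le_sum fun y _ => this i y).trans ?_
        simp_rw [Finset.sum_add_distrib, ← Finset.mul_sum]
        linarith
      have h : (∑ i, ∑ y, W (x i) y * (Real.log (W (x i) y) - Real.log (q y)) ^ 2)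
          / (n * ε) ^ 2 ≤ n * (8 * Fintype.card Y) / (n * ε) ^ 2 := by gcongr
      have h' : n * (8 * Fintype.card Y) / (n * ε) ^ 2
          = 8 * Fintype.card Y / (n * ε ^ 2) := by field_simp
      linarith
    · intro y hy hdev
      rw [hmean fun a y => Real.log (W a y) - Real.log (q y), ← mutualInfo_eq_sum,
        Finset.sum_sub_distrib] at hdev
      rw [power, ← Real.log_le_log_iff (Finset.prod_pos fun i _ => hy i)
        (mul_pos (Real.exp_pos _) (Finset.prod_pos fun i _ => hqpos y hy i)),
        Real.log_mul (Real.exp_pos _).ne' (Finset.prod_pos fun i _ => hqpos y hy i).ne',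
        Real.log_exp, Real.log_prod fun i _ => (hqpos y hy i).ne',
        Real.log_prod fun i _ => (hy i).ne']
      linarith [(abs_lt.mp hdev).2]
  have hunion : ∀ y : Fin n → Y,
      (if Real.exp (-(n * (entropy q + ε))) ≤ ∏ i, q (y i) then power W x y else 0)
      + (if power W x y ≤ Real.exp (n * (mutualInfo P W + ε)) * ∏ i, q (y i)
        then power W x y else 0) - power W x y
      ≤ if IsTypical W hn ε x y then power W x y else 0 := by
    intro y
    have := power_nonneg W x y
    unfold IsTypical
    rw [← hP, ← hq]
    split_ifs <;> first | linarith | (exfalso; tauto)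
  have htot := Finset.sum_le_sum fun y (_ : y ∈ Finset.univ) => hunion y
  rw [Finset.sum_sub_distrib, Finset.sum_add_distrib, sum_power] at htot
  have : 10 * (Fintype.card Y : ℝ) / (n * ε ^ 2)
      = 2 * Fintype.card Y / (n * ε ^ 2) + 8 * Fintype.card Y / (n * ε ^ 2) := by ring
  linarith

/-- Achievability for a fixed block length, with explicit error. -/
theorem exists_code_of_pos [Nonempty X] (W : X → stdSimplex ℝ Y) (hn : 0 < n) {ε : ℝ} (hε : 0 < ε)
    {M N L : ℕ} (hM : 0 < M) (hN : 0 < N) (hL : 0 < L) {η : ℝ} (hη : 0 < η) :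
    ∃ S : FeedbackCode X Y n M (L * N), S.IsUniform ∧ S.Simulates W
      (2 * (n * Real.log (Fintype.card X) / L + (10 * Fintype.card Y / (n * ε ^ 2) + (η +
        ((n + 1) ^ Fintype.card X * Real.exp (n * (maxOutputEntropy W + ε)) / (N * M) +
          (n + 1) ^ Fintype.card X * Real.exp (n * (capacity W + ε)) / M) / (2 * η)) / 2))) := by
  classical
  obtain ⟨Q, hQ0, hQ, hdom⟩ := exists_universal_dist W hn
  have hc : (0 : ℝ) < (n + 1 : ℝ) ^ Fintype.card X := by positivity
  have hmax : ∀ x : Fin n → X, entropy (outputDist (empiricalDist hn x) W) ≤ maxOutputEntropy W :=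
    fun x => (isGreatest_maxOutputEntropy W).2 ⟨_, rfl⟩
  have hcap : ∀ x : Fin n → X, mutualInfo (empiricalDist hn x) W ≤ capacity W :=
    fun x => (isGreatest_capacity W).2 ⟨_, rfl⟩
  set A : ℝ := (n + 1) ^ Fintype.card X * Real.exp (n * (maxOutputEntropy W + ε)) with hA
  set K : ℝ := (n + 1) ^ Fintype.card X * Real.exp (n * (capacity W + ε)) with hK
  have hA0 : 0 ≤ A := by positivity
  have hK0 : 0 ≤ K := by positivity
  have hQA : ∀ x y, IsTypical W hn ε x y → 1 ≤ A * Q y := by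
    intro x y hty
    have h1 : Real.exp (-(n * (maxOutputEntropy W + ε))) ≤ (n + 1 : ℝ) ^ Fintype.card X * Q y := by
      refine le_trans ?_ (hty.1.trans (hdom x y))
      gcongr
      exact hmax x
    rw [Real.exp_neg, inv_le_iff_one_le_mul₀ (Real.exp_pos _)] at h1
    linarith
  have hQK : ∀ x y, IsTypical W hn ε x y → power W x y ≤ K * Q y := by
    intro x y hty
    calc power W x y ≤ Real.exp (n * (mutualInfo (empiricalDist hn x) W + ε))
          * ((n + 1 : ℝ) ^ Fintype.card X * Q y) :=
          hty.2.trans (mul_le_mul_of_nonneg_left (hdom x y) (Real.exp_pos _).le)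
      _ ≤ Real.exp (n * (capacity W + ε)) * ((n + 1 : ℝ) ^ Fintype.card X * Q y) := by
          have := hQ0 y
          gcongr
          exact hcap x
      _ = K * Q y := by rw [hK]; ring
  have hQpos : ∀ x y, IsTypical W hn ε x y → 0 < Q y := fun x y hty =>
    (hQ0 y).lt_of_ne' fun h => by have := hQA x y hty; rw [h, mul_zero] at this; linarith
  set w : (Fin n → X) → (Fin n → Y) → ℝ :=
    fun x y => if IsTypical W hn ε x y then power W x y / Q y else 0 with hw
  have hw0 : ∀ x y, 0 ≤ w x y := by
    intro x y
    simp only [hw]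
    split_ifs
    · exact div_nonneg (power_nonneg W x y) (hQ0 y)
    · exact le_rfl
  have hwQ : ∀ x y, w x y * Q y = if IsTypical W hn ε x y then power W x y else 0 := by
    intro x y
    simp only [hw]
    split_ifs with h
    · exact div_mul_cancel₀ _ (hQpos x y h).ne'
    · exact zero_mul _
  refine exists_code W hM hN hL hw0 hQ0 hQ (by positivity) fun x => ?_
  refine (mean_error_bookLaw_le hN hM (sum_power W x) hQ0 hQ (hw0 x) (fun y => ?_)
    (δ := 10 * Fintype.card Y / (n * ε ^ 2)) ?_ (K := K) hA0 (fun y => ?_) (fun y hy => ?_)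
    hη).trans (le_of_eq ?_)
  · rw [hwQ]
    split_ifs
    · exact le_rfl
    · exact power_nonneg W x y
  · simp_rw [hwQ]
    exact prob_isTypical_ge W hn hε x
  · simp only [hw]
    split_ifs with h
    · rw [div_le_iff₀ (hQpos x y h)]
      exact hQK x y h
    · exact hK0
  · by_contra hlt
    exact hy (if_neg fun h => hlt (hQA x y h))
  · ring

end Types

/-! ### Asymptotics -/

theorem tendsto_succ_pow_mul_exp_neg (k : ℕ) {b : ℝ} (hb : 0 < b) :
    Tendsto (fun n : ℕ => ((n : ℝ) + 1) ^ k * Real.exp (-(n * b))) atTop (nhds 0) := by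
  have h := ((tendsto_rpow_mul_exp_neg_mul_atTop_nhds_zero k b hb).comp
    (tendsto_natCast_atTop_atTop.atTop_add (tendsto_const_nhds (x := (1 : ℝ))))).mul_const
      (Real.exp b)
  rw [zero_mul] at h
  refine h.congr fun n => ?_
  simp only [Function.comp_apply, Real.rpow_natCast]
  rw [mul_assoc, ← Real.exp_add]
  congr 2
  ring

theorem le_two_mul_floor {r : ℝ} (hr : 1 ≤ r) : r ≤ 2 * (⌊r⌋₊ : ℝ) := by
  have h1 : (1 : ℝ) ≤ ⌊r⌋₊ := by exact_mod_cast (Nat.one_le_floor_iff r).mpr hr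
  linarith [Nat.lt_floor_add_one r]

/-- The direct part of the rate region.  The margin `ε` in the rates is used for the typicality
bounds, for the polynomial factors, and for the number of codebooks. -/
theorem isAchievable_of_le {X Y : Type*} [Fintype X] [Nonempty X] [Fintype Y]
    (W : X → stdSimplex ℝ Y) {lam R C : ℝ} (hlam : 0 < lam) (hC : 0 ≤ C)
    (hR : capacity W ≤ R) (hRC : maxOutputEntropy W ≤ R + C) : IsAchievable W lam R C := by
  classical
  intro ε hε
  have hR0 := (capacity_nonneg W).trans hR
  set k := Fintype.card X
  have h1 : Tendsto (fun n : ℕ => 2 * (Real.log k / n)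
      + 20 * Fintype.card Y / (n * (ε / 4) ^ 2)
      + 6 / lam * (((n : ℝ) + 1) ^ k * Real.exp (-(n * (ε / 2))))) atTop
      (nhds (2 * 0 + 0 + 6 / lam * 0)) :=
    (((tendsto_const_nhds.div_atTop tendsto_natCast_atTop_atTop).const_mul 2).add
      (tendsto_const_nhds.div_atTop
        (tendsto_natCast_atTop_atTop.atTop_mul_const (by positivity)))).add
      ((tendsto_succ_pow_mul_exp_neg k (by positivity)).const_mul _)
  have h2 := tendsto_succ_pow_mul_exp_neg 2 (b := ε / 2) (by positivity)
  filter_upwards [h1.eventually_lt_const (show 2 * 0 + 0 + 6 / lam * 0 < lam / 2 by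
    rw [mul_zero, mul_zero, zero_add, zero_add]; linarith),
    h2.eventually_lt_const one_pos, eventually_gt_atTop 0] with n hn1 hn2 hn
  have hn' : (0 : ℝ) < n := by exact_mod_cast hn
  set M := ⌊Real.exp (n * (R + ε))⌋₊ with hM
  set N := ⌊Real.exp (n * (C + ε / 2))⌋₊ with hN
  have hM2 : Real.exp (n * (R + ε)) ≤ 2 * (M : ℝ) :=
    le_two_mul_floor (Real.one_le_exp (by positivity))
  have hN2 : Real.exp (n * (C + ε / 2)) ≤ 2 * (N : ℝ) :=
    le_two_mul_floor (Real.one_le_exp (by positivity))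
  have hMle : (M : ℝ) ≤ Real.exp (n * (R + ε)) := Nat.floor_le (Real.exp_pos _).le
  have hNle : (N : ℝ) ≤ Real.exp (n * (C + ε / 2)) := Nat.floor_le (Real.exp_pos _).le
  have hMpos : (0 : ℝ) < M := by linarith [Real.exp_pos (n * (R + ε))]
  have hNpos : (0 : ℝ) < N := by linarith [Real.exp_pos (n * (C + ε / 2))]
  -- `n ^ 2` codebooks cost no rate, and are many compared with the logarithm `n * log k` of the
  -- number of input words; the choice of `η` spends half of the admissible error
  obtain ⟨S, hSu, hS⟩ := exists_code_of_pos W hn (ε := ε / 4) (by positivity)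
    (M := M) (N := N) (L := n ^ 2) (by exact_mod_cast hMpos) (by exact_mod_cast hNpos)
    (by positivity) (η := lam / 2) (by positivity)
  refine ⟨M, n ^ 2 * N, S, hSu, fun x => (hS x).trans ?_, ?_, ?_⟩
  · set E := ((n : ℝ) + 1) ^ k * Real.exp (-(n * (ε / 2))) with hE
    have hbound1 : ((n : ℝ) + 1) ^ k * Real.exp (n * (maxOutputEntropy W + ε / 4)) / (N * M)
        ≤ 4 * E := by
      rw [div_le_iff₀ (by positivity)]
      calc ((n : ℝ) + 1) ^ k * Real.exp (n * (maxOutputEntropy W + ε / 4))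
          ≤ ((n : ℝ) + 1) ^ k * Real.exp (-(n * (ε / 2)) + n * (C + ε / 2) + n * (R + ε)) := by
            gcongr
            nlinarith
        _ = E * (Real.exp (n * (C + ε / 2)) * Real.exp (n * (R + ε))) := by
            rw [Real.exp_add, Real.exp_add, hE]; ring
        _ ≤ E * ((2 * N) * (2 * M)) := by gcongr
        _ = 4 * E * (N * M) := by ring
    have hbound2 : ((n : ℝ) + 1) ^ k * Real.exp (n * (capacity W + ε / 4)) / M ≤ 2 * E := by
      rw [div_le_iff₀ (by positivity)]
      calc ((n : ℝ) + 1) ^ k * Real.exp (n * (capacity W + ε / 4))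
          ≤ ((n : ℝ) + 1) ^ k * Real.exp (-(n * (ε / 2)) + n * (R + ε)) := by
            gcongr
            nlinarith
        _ = E * Real.exp (n * (R + ε)) := by
            rw [Real.exp_add, hE]; ring
        _ ≤ E * (2 * M) := by gcongr
        _ = 2 * E * M := by ring
    have e1 : (n : ℝ) * Real.log k / ((n ^ 2 : ℕ) : ℝ) = Real.log k / n := by
      push_cast; field_simp
    rw [e1]
    have e2 : 20 * (Fintype.card Y : ℝ) / (n * (ε / 4) ^ 2)
        = 2 * (10 * Fintype.card Y / (n * (ε / 4) ^ 2)) := by ring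
    have e3 : (((n : ℝ) + 1) ^ k * Real.exp (n * (maxOutputEntropy W + ε / 4)) / (N * M) +
        ((n : ℝ) + 1) ^ k * Real.exp (n * (capacity W + ε / 4)) / M) / (2 * (lam / 2))
        ≤ 6 / lam * E := by
      rw [div_le_iff₀ (by positivity)]
      have : 6 / lam * E * (2 * (lam / 2)) = 6 * E := by field_simp
      linarith
    linarith
  · rw [FeedbackCode.rate, div_le_iff₀ hn', Real.log_le_iff_le_exp hMpos]
    rwa [mul_comm]
  · have hLN : (0 : ℝ) < ((n ^ 2 * N : ℕ) : ℝ) := by push_cast; positivity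
    rw [FeedbackCode.crRate, div_le_iff₀ hn', Real.log_le_iff_le_exp hLN]
    have hsq : (n : ℝ) ^ 2 ≤ Real.exp (n * (ε / 2)) := by
      rw [Real.exp_neg, mul_inv_lt_iff₀ (Real.exp_pos _), one_mul] at hn2
      nlinarith
    calc ((n ^ 2 * N : ℕ) : ℝ) = (n : ℝ) ^ 2 * N := by push_cast; ring
      _ ≤ Real.exp (n * (ε / 2)) * Real.exp (n * (C + ε / 2)) := by gcongr
      _ = Real.exp ((C + ε) * n) := by rw [← Real.exp_add]; congr 1; ring

section Bounds

variable {X Y : Type*} [Fintype X] [Nonempty X] [Fintype Y]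

theorem eventually_rates_ge (W : X → stdSimplex ℝ Y) {lam : ℝ} (hlam : lam < 1) {ε : ℝ}
    (hε : 0 < ε) :
    ∀ᶠ n : ℕ in atTop, ∀ (M N : ℕ) (S : FeedbackCode X Y n M N), S.Simulates W lam →
      capacity W - ε ≤ S.rate ∧ maxOutputEntropy W - ε ≤ S.rate + S.crRate := by
  obtain ⟨P, hP⟩ := (isGreatest_capacity W).1
  obtain ⟨P', hP'⟩ := (isGreatest_maxOutputEntropy W).1
  filter_upwards [eventually_mutualInfo_le_rate W P hlam (half_pos hε),
    eventually_entropy_le_rate_add_crRate W P' hlam (half_pos hε)] with n h1 h2 M N S hS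
  have h1 := h1 M N S hS
  have h2 := h2 M N S hS
  dsimp only at hP hP'
  rw [hP] at h1
  rw [hP'] at h2
  constructor <;> linarith

theorem le_of_isAchievable (W : X → stdSimplex ℝ Y) {lam R C : ℝ} (hlam : lam < 1)
    (h : IsAchievable W lam R C) :
    0 ≤ C ∧ capacity W ≤ R ∧ maxOutputEntropy W ≤ R + C := by
  have key : ∀ ε > 0, 0 ≤ C + ε ∧ capacity W ≤ R + ε ∧ maxOutputEntropy W ≤ R + C + ε := by
    intro ε hε
    obtain ⟨n, h1, h2⟩ := ((h (ε / 3) (by positivity)).and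
      (eventually_rates_ge W hlam (show 0 < ε / 3 by positivity))).exists
    obtain ⟨M, N, S, -, hS, hSR, hSC⟩ := h1
    obtain ⟨h3, h4⟩ := h2 M N S hS
    have h5 : 0 ≤ S.crRate :=
      div_nonneg (Real.log_natCast_nonneg N) (Nat.cast_nonneg n)
    refine ⟨?_, ?_, ?_⟩ <;> linarith
  exact ⟨le_of_forall_pos_le_add fun ε hε => (key ε hε).1,
    le_of_forall_pos_le_add fun ε hε => (key ε hε).2.1,
    le_of_forall_pos_le_add fun ε hε => (key ε hε).2.2⟩

end Bounds

end ChannelSimulation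

theorem mainTheorem5 {X Y : Type*} [Fintype X] [Nonempty X] [Fintype Y]
    (W : X → stdSimplex ℝ Y) :
    -- the two suprema are maxima
    IsGreatest (Set.range fun P : stdSimplex ℝ X => ChannelSimulation.mutualInfo P W)
      (ChannelSimulation.capacity W) ∧
    IsGreatest (Set.range fun P : stdSimplex ℝ X =>
        ChannelSimulation.entropy (ChannelSimulation.outputDist P W))
      (ChannelSimulation.maxOutputEntropy W) ∧
    -- lower bounds, for every code and every distribution of the common randomness
    (∀ lam : ℝ, lam < 1 → ∀ ε > 0, ∀ᶠ n : ℕ in atTop,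
      ∀ (M N : ℕ) (S : ChannelSimulation.FeedbackCode X Y n M N), S.Simulates W lam →
        ChannelSimulation.capacity W - ε ≤ S.rate ∧
        ChannelSimulation.maxOutputEntropy W - ε ≤ S.rate + S.crRate) ∧
    -- the region of achievable rate pairs
    (∀ lam : ℝ, 0 < lam → lam < 1 → ∀ R C : ℝ,
      ChannelSimulation.IsAchievable W lam R C ↔
        0 ≤ C ∧ ChannelSimulation.capacity W ≤ R ∧
        ChannelSimulation.maxOutputEntropy W ≤ R + C) := by
  refine ⟨ChannelSimulation.isGreatest_capacity W, ChannelSimulation.isGreatest_maxOutputEntropy W,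
    fun lam hlam ε hε => ChannelSimulation.eventually_rates_ge W hlam hε, ?_⟩
  exact fun lam hlam0 hlam R C => ⟨ChannelSimulation.le_of_isAchievable W hlam,
    fun h => ChannelSimulation.isAchievable_of_le W hlam0 h.1 h.2.1 h.2.2⟩
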